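/- **Theorem (on embedding).** Let $d\ge 1$, let $D\subset\mathbb R^d$ be a domain whose boundary $\partial D$ in $\mathbb R^d$ is non-polar (i.e. there is no subharmonic function $u\not\equiv-\infty$ on $\mathbb R^d$ with $u=-\infty$ on $\partial D$), let $S_o\subset\mathbb R^d$, $o\in\operatorname{Int}S_o$, $r>0$, and let $D_o$ be a domain with $$o\in\operatorname{Int}S_o\Subset S_o^{\cup 4r}\Subset D_o\Subset D,$$ where $S_o^{\cup 4r}$ is the union of the open balls of radius $4r$ centred at points of $S_o$, and $Q'\Subset Q$ means that the closure of $Q'$ is compact and contained in the interior of $Q$. Notation. Subharmonic functions take values in $[-\infty,+\infty)$ (the function $-\infty$ is allowed; for $d=1$ they are the convex functions and $-\infty$). $\mathrm{sbh}(Q)$ is the class of restrictions to $Q$ of functions subharmonic on open sets containing $Q$; $\mathrm{har}(Q)=\mathrm{sbh}(Q)\cap(-\mathrm{sbh}(Q))$. $\mathrm{sbh}_{00}(D\setminus S)$ is the class of $v\in\mathrm{sbh}(D\setminus S)$ that vanish on $(D\setminus S)\setminus S(v)$ for some $S(v)\Subset D$. For $B>0$, - $\mathrm{sbh}_{00}(D\setminus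 S_o;r,-B<B)$ consists of the $v\in\mathrm{sbh}_{00}(D\setminus S_o)$ with $v\le B$ on $D\setminus S_o$ and $v\ge -B$ on $S_o^{\cup 4r}\setminus S_o$; - $\mathrm{sbh}^+_{00}(D\setminus S_o;\le B)$ consists of the $v\in\mathrm{sbh}_{00}(D\setminus S_o)$ with $0\le v\le B$ on $D\setminus S_o$. Put $K_{d-2}(o,y)=\ln|y-o|$ if $d=2$, $K_{d-2}(o,y)=-|y-o|^{2-d}$ if $d\ge3$, and $K_{-1}(o,y)=|y-o|$ if $d=1$, for $y\ne o$. $ASP^1(D\setminus o)$ (Arens–Singer potentials, normalized at the pole $o$) is the class of $V\in\mathrm{sbh}_{00}(D\setminus\{o\})$ with $V(y)=-K_{d-2}(o,y)+O(1)$ as $o\ne y\to o$, and $JP^1(D\setminus o)$ (Jensen potentials) is the class of $V\in ASP^1(D\setminus o)$ with $V\ge0$ on $D\setminus\{o\}$. If $d=1$, where the $O(1)$ condition does not normalize $V$, only those $V$ are considered below for which $V+K_{-1}(o,\cdot)$ extends to a convex function on $D$; for $d\ge2$ there is no such restriction. Then there is a constant $B>0$, depending only on $d,D,o,S_o,r,D_o$,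 such that (with the above restriction on $V$ if $d=1$) 1. if $S_o$ is connected, every $V\in ASP^1(D\setminus o)\cap\mathrm{har}(D_o\setminus\{o\})$ belongs to $\mathrm{sbh}_{00}(D\setminus S_o;r,-B<B)$; 2. every $V\in JP^1(D\setminus o)\cap\mathrm{har}(D_o\setminus\{o\})$ belongs to $\mathrm{sbh}^+_{00}(D\setminus S_o;\le B)$. -/

import Mathlib

open MeasureTheory Metric Set Filter Topology
open scoped ENNReal

noncomputable section

namespace PotentialTheory

/-- The Euclidean space `ℝ^d`. -/
abbrev Space (d : ℕ) : Type := EuclideanSpace ℝ (Fin d)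

/-- `Q' ⋐ Q` for subsets of `ℝ^d`: the closure of `Q'` in the one-point compactification of `ℝ^d`
is contained in the interior of `Q`. For `Q ⊆ ℝ^d` this closure misses the point at infinity, so it
is the usual closure of `Q'` and it is compact. -/
def PrecompactIn {d : ℕ} (Q' Q : Set (Space d)) : Prop :=
  IsCompact (closure Q') ∧ closure Q' ⊆ interior Q

/-- The surface measure on the unit sphere of `ℝ^d`, normalized to total mass `1`
(for `d = 1`: mass `1/2` at each of the two points `±1`). -/
def sphereProb (d : ℕ) : Measure (sphere (0 : Space d) 1) :=
  ((volume : Measure (Space d)).toSphere univ)⁻¹ • (volume : Measure (Space d)).toSphere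

/-- The mean of an extended real function over the sphere of centre `x` and radius `ρ`:
the integral of the positive part minus the integral of the negative part. -/
def sphereMean {d : ℕ} (v : Space d → EReal) (x : Space d) (ρ : ℝ) : EReal :=
  ((∫⁻ s, (v (x + ρ • (s : Space d))).toENNReal ∂(sphereProb d) : ℝ≥0∞) : EReal)
    - ((∫⁻ s, (-v (x + ρ • (s : Space d))).toENNReal ∂(sphereProb d) : ℝ≥0∞) : EReal)

/-- Subharmonic functions on an open set `O`: upper semicontinuous functions with values in
`[-∞, +∞)` that satisfy the sub-mean value inequality. The function `-∞` is allowed. Only the values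
of `v` on `O` matter. -/
structure IsSubharmonicOn {d : ℕ} (v : Space d → EReal) (O : Set (Space d)) : Prop where
  isOpen : IsOpen O
  ne_top : ∀ x ∈ O, v x ≠ ⊤
  usc : UpperSemicontinuousOn v O
  submean : ∀ x ρ, 0 < ρ → closedBall x ρ ⊆ O → v x ≤ sphereMean v x ρ

/-- `E ⊆ ℝ^d` is polar if it lies in the minus-infinity set of a subharmonic function `u ≢ -∞`
on `ℝ^d`. -/
def IsPolar {d : ℕ} (E : Set (Space d)) : Prop :=
  ∃ u : Space d → EReal, IsSubharmonicOn u univ ∧ (∃ x, u x ≠ ⊥) ∧ ∀ x ∈ E, u x = ⊥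

/-- `sbh(Q)`: restrictions to `Q` of functions subharmonic on open sets that include `Q`. A function
on `Q` is represented by any extension of it to `ℝ^d`: membership depends on the values on `Q`
only. -/
def sbh {d : ℕ} (Q : Set (Space d)) : Set (Space d → EReal) :=
  {v | ∃ (O : Set (Space d)) (u : Space d → EReal), Q ⊆ O ∧ IsSubharmonicOn u O ∧ EqOn v u Q}

/-- `har(Q) = sbh(Q) ∩ (-sbh(Q))`. -/
def har {d : ℕ} (Q : Set (Space d)) : Set (Space d → EReal) :=
  {v | v ∈ sbh Q ∧ (fun x => -v x) ∈ sbh Q}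

/-- For a class `F` of functions on `Q`, the class `F⁺` of those `f` in `F` with `f = max {0, f}`
on `Q`. -/
def posClass {d : ℕ} (Q : Set (Space d)) (F : Set (Space d → EReal)) : Set (Space d → EReal) :=
  {f | f ∈ F ∧ ∀ x ∈ Q, f x = max 0 (f x)}

/-- `sbh₀₀(D ∖ S)`: functions from `sbh(D ∖ S)` vanishing near the boundary of `D` in the one-point
compactification of `ℝ^d`, i.e. outside some `S_v ⋐ D`. -/
def sbh00 {d : ℕ} (D S : Set (Space d)) : Set (Space d → EReal) :=
  {v | v ∈ sbh (D \ S) ∧ ∃ Sv : Set (Space d), PrecompactIn Sv D ∧ ∀ x ∈ (D \ S) \ Sv, v x = 0}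

/-- `sbh₀₀(D ∖ S; ≤ b)`. -/
def sbh00Le {d : ℕ} (D S : Set (Space d)) (b : ℝ) : Set (Space d → EReal) :=
  {v | v ∈ sbh00 D S ∧ ∀ x ∈ D \ S, v x ≤ (b : EReal)}

/-- `sbh₀₀⁺(D ∖ S; ≤ b)`. -/
def sbh00PosLe {d : ℕ} (D S : Set (Space d)) (b : ℝ) : Set (Space d → EReal) :=
  posClass (D \ S) (sbh00Le D S b)

/-- `sbh₀₀(D ∖ S; r, b₋ < b₊)`; here `thickening (4 * r) S` is the union of the open balls of radius
`4r` with centres in `S`. -/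
def sbh00Between {d : ℕ} (D S : Set (Space d)) (r bminus bplus : ℝ) : Set (Space d → EReal) :=
  {v | v ∈ sbh00Le D S bplus ∧ ∀ x ∈ thickening (4 * r) S \ S, (bminus : EReal) ≤ v x}

/-- The function `k_q(t)`, `t > 0`: `ln t` for `q = 0`, and `-sgn(q) t^{-q}` for `q ≠ 0`. -/
def kFun (q t : ℝ) : ℝ :=
  if q = 0 then Real.log t else -Real.sign q * t ^ (-q)

/-- The kernel `K_{d-2}(x, y)`. -/
def kernelK {d : ℕ} (x y : Space d) : EReal :=
  if x ≠ y then ((kFun ((d : ℝ) - 2) ‖x - y‖ : ℝ) : EReal) else if d = 1 then 0 else ⊥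

/-- `ASP(D ∖ o)`, the Arens–Singer potentials on `D` with pole at `o`: `V ∈ sbh₀₀(D ∖ o)` with
`V(y) ≤ -K_{d-2}(o, y) + O(1)` as `o ≠ y → o`. -/
def ASP {d : ℕ} (D : Set (Space d)) (o : Space d) : Set (Space d → EReal) :=
  {V | V ∈ sbh00 D {o} ∧ ∃ C : ℝ, ∀ᶠ y in 𝓝[≠] o, V y ≤ -kernelK o y + (C : EReal)}

/-- `ASP¹(D ∖ o)`: those `V ∈ ASP(D ∖ o)` with `V(y) = -K_{d-2}(o, y) + O(1)` as `o ≠ y → o`. -/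
def ASP1 {d : ℕ} (D : Set (Space d)) (o : Space d) : Set (Space d → EReal) :=
  {V | V ∈ ASP D o ∧ ∃ C : ℝ, ∀ᶠ y in 𝓝[≠] o,
    -kernelK o y - (C : EReal) ≤ V y ∧ V y ≤ -kernelK o y + (C : EReal)}

/-- `JP¹(D ∖ o) = (ASP¹(D ∖ o))⁺`: Jensen potentials with the same normalization at the pole. -/
def JP1 {d : ℕ} (D : Set (Space d)) (o : Space d) : Set (Space d → EReal) :=
  posClass (D \ {o}) (ASP1 D o)

/-- The functions `V` on `D ∖ o` for which `V + K_{d-2}(o, ·)` extends to a subharmonic function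
on `D`. The theorem uses this class in dimension one only: there `K_{-1}(o, y) = |y - o|` is bounded
near `o`, so that `V = -K_{-1}(o, ·) + O(1)` does not normalize `V` at the pole. -/
def poleExtends {d : ℕ} (D : Set (Space d)) (o : Space d) : Set (Space d → EReal) :=
  {V | ∃ W ∈ sbh D, ∀ y ∈ D \ {o}, W y = V y + kernelK o y}

end PotentialTheory

end

open PotentialTheory

/-!
Only the uniform bounds need an argument; membership in the classes is inherited under restriction
from `D ∖ o` to `D ∖ S`.

A potential `V` is cut off from below and continued by `0` outside `D` (`truncExt`). The result is a
real function on `ℝ^d` with the local sub-mean value property (`LocSub`) off the pole `o`, and it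
vanishes outside a compact set, so by the maximum principle its supremum outside a ball about `o` is
attained on the sphere and is nonnegative (`exists_truncExt_max_sphere`). In particular `V ≥ 0`
somewhere on each small sphere.

*Upper bound, `d ≥ 3`.* The condition at the pole and the maximum principle give
`V ≤ 2 |· - o|^{2-d}` (`truncExt_le_rpow`).

*Upper bound, `d = 2`* (`exists_planar_bound`). If the maxima `cₙ` of potentials `Vₙ` on a fixed
circle satisfy `cₙ ≥ 2ⁿ`, consider the sum of `2⁻ⁿ (Gₙ - cₙ)`, where `Gₙ = max (Vₙ + L, 0)` and `L`
is a strictly subharmonic function with a logarithmic pole strong enough to make `Gₙ` vanish near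
`o`. The terms are subharmonic on the plane with a common majorant. The sum is `-∞` on `∂D`, where
`Vₙ = 0`. It is finite at a point of the circle: `cₙ + const - Vₙ` is a nonnegative harmonic
function near the circle and bounded at one of its points, hence, by Harnack's inequality
(`exists_harnack`), on the whole circle. So `∂D` would be polar. That the sum satisfies
the sub-mean value inequality for all circles, as subharmonicity demands, follows from the local one
by averaging over finitely many rotations (`LocSub.le_integral`).

*Lower bound, `d ≥ 2`* (`exists_lower_bound`). With `B` the upper bound, `B - V` is a nonnegative
harmonic function away from the pole which is at most `B` at some point of a small sphere, since
`V ≥ 0` there. Harnack's inequality on `D₀ ∖ o`, which is connected, bounds it on compact sets.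

*The line.* A potential is nonnegative, by the maximum principle on the half-line that starts at a
given point and leads away from `o` (`nonneg_of_mem_sbh00`), and `V + |· - o|` is dominated by
`|· - p| + |o - p|` for a boundary point `p` of `D` (`le_of_mem_poleExtends`).
-/

noncomputable section

namespace PotentialTheory

section

variable {d : ℕ}

/-! ### The normalized surface measure -/

instance [NeZero d] : IsProbabilityMeasure (sphereProb d) := by
  refine ⟨?_⟩
  rw [sphereProb, Measure.smul_apply, smul_eq_mul]
  exact ENNReal.inv_mul_cancel (Measure.measure_univ_ne_zero.2 (Measure.toSphere_ne_zero _))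
    (measure_ne_top _ _)

instance [NeZero d] : (sphereProb d).IsOpenPosMeasure := by
  rw [sphereProb]
  exact Measure.isOpenPosMeasure_smul _ (ENNReal.inv_ne_zero.2 (measure_ne_top _ _))

/-- The action of a linear isometry on the unit sphere. -/
def sphereMap (A : Space d ≃ₗᵢ[ℝ] Space d) (s : sphere (0 : Space d) 1) : sphere (0 : Space d) 1 :=
  ⟨A s, by simp⟩

theorem continuous_sphereMap (A : Space d ≃ₗᵢ[ℝ] Space d) : Continuous (sphereMap A) :=
  (A.continuous.comp continuous_subtype_val).subtype_mk _

open scoped Pointwise in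
/-- The cone over a set of directions is carried by a linear isometry to the cone over the image,
and linear isometries preserve the volume. -/
theorem measurePreserving_sphereMap (A : Space d ≃ₗᵢ[ℝ] Space d) :
    MeasurePreserving (sphereMap A) (sphereProb d) (sphereProb d) := by
  refine ⟨(continuous_sphereMap A).measurable, ?_⟩
  have key : (volume : Measure (Space d)).toSphere.map (sphereMap A)
      = (volume : Measure (Space d)).toSphere := by
    ext t ht
    rw [Measure.map_apply (continuous_sphereMap A).measurable ht,
      Measure.toSphere_apply' _ ((continuous_sphereMap A).measurable ht),
      Measure.toSphere_apply' _ ht]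
    congr 1
    have h : Ioo (0 : ℝ) 1 • (((↑) : _ → Space d) '' (sphereMap A ⁻¹' t))
        = A ⁻¹' (Ioo (0 : ℝ) 1 • (((↑) : _ → Space d) '' t)) := by
      ext x
      simp only [Set.mem_smul, mem_image, mem_preimage]
      constructor
      · rintro ⟨c, hc, _, ⟨s, hs, rfl⟩, rfl⟩
        exact ⟨c, hc, _, ⟨_, hs, rfl⟩, by simp [sphereMap]⟩
      · rintro ⟨c, hc, _, ⟨s, hs, rfl⟩, h⟩
        refine ⟨c, hc, _, ⟨sphereMap A.symm s, ?_, rfl⟩, ?_⟩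
        · convert hs
          simp [sphereMap]
        · apply A.injective
          simp [← h, sphereMap]
    rw [h, A.measurePreserving.measure_preimage_emb A.toHomeomorph.measurableEmbedding]
  rw [sphereProb, Measure.map_smul, key]

theorem integral_sphereMap (A : Space d ≃ₗᵢ[ℝ] Space d) (f : sphere (0 : Space d) 1 → ℝ) :
    ∫ s, f (sphereMap A s) ∂(sphereProb d) = ∫ s, f s ∂(sphereProb d) := by
  refine (measurePreserving_sphereMap A).integral_comp
    (Continuous.measurableEmbedding (continuous_sphereMap A) ?_) f
  intro s t h
  have := congrArg Subtype.val h
  exact Subtype.ext (A.injective this)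

theorem integrable_of_continuous [NeZero d] {f : sphere (0 : Space d) 1 → ℝ} (hf : Continuous f) :
    Integrable f (sphereProb d) :=
  hf.integrable_of_hasCompactSupport (HasCompactSupport.of_compactSpace f)

theorem integral_inner_sphere (x : Space d) :
    ∫ s : sphere (0 : Space d) 1, inner ℝ x (s : Space d) ∂(sphereProb d) = 0 := by
  have h := integral_sphereMap (LinearIsometryEquiv.neg ℝ (E := Space d))
    fun s => inner ℝ x (s : Space d)
  simp only [sphereMap, LinearIsometryEquiv.coe_neg, inner_neg_right, integral_neg] at h
  linarith

/-- By rotation invariance the second moment in a given direction does not depend on the direction,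
and the moments in the `d` coordinate directions add up to `1`. -/
theorem integral_inner_sq_sphere [NeZero d] (x : Space d) :
    ∫ s : sphere (0 : Space d) 1, (inner ℝ x (s : Space d)) ^ 2 ∂(sphereProb d)
      = ‖x‖ ^ 2 / d := by
  have inv : ∀ a b : Space d, ‖a‖ = ‖b‖ →
      ∫ s : sphere (0 : Space d) 1, (inner ℝ a (s : Space d)) ^ 2 ∂(sphereProb d)
      = ∫ s : sphere (0 : Space d) 1, (inner ℝ b (s : Space d)) ^ 2 ∂(sphereProb d) := by
    intro a b hab
    have hr := Submodule.reflection_sub hab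
    rw [← integral_sphereMap ((ℝ ∙ (a - b))ᗮ.reflection) fun s => (inner ℝ b (s : Space d)) ^ 2]
    refine integral_congr_ae (Eventually.of_forall fun s => ?_)
    simp only [sphereMap]
    conv_rhs => rw [← hr]
    rw [hr, ← LinearIsometryEquiv.inner_map_map ((ℝ ∙ (a - b))ᗮ.reflection) a, hr]
  have hd : (d : ℝ) ≠ 0 := Nat.cast_ne_zero.2 (NeZero.ne d)
  set e : Fin d → Space d := fun i => EuclideanSpace.single i ‖x‖ with he
  have hi : ∀ i, ∫ s : sphere (0 : Space d) 1, (inner ℝ (e i) (s : Space d)) ^ 2 ∂(sphereProb d)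
      = ∫ s : sphere (0 : Space d) 1, (inner ℝ x (s : Space d)) ^ 2 ∂(sphereProb d) :=
    fun i => inv _ _ (by simp [he])
  have hsum : ∑ i, ∫ s : sphere (0 : Space d) 1, (inner ℝ (e i) (s : Space d)) ^ 2 ∂(sphereProb d)
      = ‖x‖ ^ 2 := by
    rw [← integral_finsetSum]
    · have : ∀ s : sphere (0 : Space d) 1, ∑ i, (inner ℝ (e i) (s : Space d)) ^ 2 = ‖x‖ ^ 2 := by
        intro s
        have hs : ‖(s : Space d)‖ ^ 2 = 1 := by simp
        rw [EuclideanSpace.norm_sq_eq] at hs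
        simp only [Real.norm_eq_abs, sq_abs] at hs
        simp only [he, EuclideanSpace.inner_single_left, mul_pow, ← Finset.mul_sum]
        simp [hs]
      simp [this]
    · intro i _
      exact integrable_of_continuous (by fun_prop)
  rw [Finset.sum_congr rfl fun i _ => hi i] at hsum
  simp only [Finset.sum_const, Finset.card_univ, Fintype.card_fin, nsmul_eq_mul] at hsum
  rw [← hsum]
  field_simp

/-- A function that is at most `M` on the sphere and less than `M` on a nonempty open part of it has
a mean less than `M`. -/
theorem integral_lt_of_le_of_lt_on_open [NeZero d] {f : sphere (0 : Space d) 1 → ℝ} {M : ℝ}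
    (hf : Integrable f (sphereProb d)) (hle : ∀ s, f s ≤ M) {U : Set (sphere (0 : Space d) 1)}
    (hU : IsOpen U) (hne : U.Nonempty) (hlt : ∀ s ∈ U, f s < M) :
    ∫ s, f s ∂(sphereProb d) < M := by
  have h0 : 0 < ∫ s, (M - f s) ∂(sphereProb d) := by
    rw [integral_pos_iff_support_of_nonneg (fun s => sub_nonneg.2 (hle s))
      ((integrable_const M).sub hf)]
    exact (hU.measure_pos (sphereProb d) hne).trans_le
      (measure_mono fun s hs => (sub_pos.2 (hlt s hs)).ne')
  rw [integral_sub (integrable_const M) hf] at h0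
  simpa using h0

end

section

variable {d : ℕ}

/-! ### Local sub-mean value property and the maximum principle -/

/-- The local sub-mean value property at `x` of a real function `φ`: `φ` is upper semicontinuous at
`x`, and it is integrable over all small spheres centred at `x` with mean at least `φ x`. -/
structure LocSub (φ : Space d → ℝ) (x : Space d) : Prop where
  usc : UpperSemicontinuousAt φ x
  submean : ∀ᶠ ρ : ℝ in 𝓝[>] 0,
    Integrable (fun s : sphere (0 : Space d) 1 => φ (x + ρ • (s : Space d))) (sphereProb d) ∧
      φ x ≤ ∫ s : sphere (0 : Space d) 1, φ (x + ρ • (s : Space d)) ∂(sphereProb d)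

/-- A neighbourhood of `x` contains all small spheres centred at `x`. -/
theorem eventually_sphere_subset {x : Space d} {p : Space d → Prop} (h : ∀ᶠ y in 𝓝 x, p y) :
    ∀ᶠ ρ : ℝ in 𝓝[>] 0, ∀ s : sphere (0 : Space d) 1, p (x + ρ • (s : Space d)) := by
  obtain ⟨ε, hε, hp⟩ := Metric.eventually_nhds_iff.1 h
  filter_upwards [Ioo_mem_nhdsGT hε] with ρ hρ s
  apply hp
  simp [norm_smul, abs_of_pos hρ.1, hρ.2]

theorem eventually_closedBall_subset {x : Space d} {U : Set (Space d)} (hU : U ∈ 𝓝 x) :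
    ∀ᶠ ρ : ℝ in 𝓝[>] 0, closedBall x ρ ⊆ U := by
  obtain ⟨ε, hε, hp⟩ := Metric.mem_nhds_iff.1 hU
  filter_upwards [Ioo_mem_nhdsGT hε] with ρ hρ
  exact (closedBall_subset_ball hρ.2).trans hp

namespace LocSub

variable {φ ψ : Space d → ℝ} {x : Space d}

theorem congr (h : LocSub φ x) (he : φ =ᶠ[𝓝 x] ψ) : LocSub ψ x := by
  refine ⟨fun y hy => ?_, ?_⟩
  · have hy' : φ x < y := by rw [he.eq_of_nhds]; exact hy
    filter_upwards [h.usc y hy', he] with z hz hz'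
    rw [← hz']
    exact hz
  · filter_upwards [h.submean, eventually_sphere_subset he] with ρ hρ hs
    have : (fun s : sphere (0 : Space d) 1 => φ (x + ρ • (s : Space d)))
      = fun s : sphere (0 : Space d) 1 => ψ (x + ρ • (s : Space d)) := funext hs
    rw [this, he.eq_of_nhds] at hρ
    exact hρ

theorem add (h : LocSub φ x) (h' : LocSub ψ x) : LocSub (fun y => φ y + ψ y) x := by
  refine ⟨h.usc.add h'.usc, ?_⟩
  filter_upwards [h.submean, h'.submean] with ρ hρ hρ'
  refine ⟨hρ.1.add hρ'.1, ?_⟩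
  rw [integral_add hρ.1 hρ'.1]
  exact add_le_add hρ.2 hρ'.2

theorem const [NeZero d] (c : ℝ) (x : Space d) : LocSub (fun _ => c) x := by
  refine ⟨upperSemicontinuousAt_const, Eventually.of_forall fun ρ => ⟨integrable_const c, ?_⟩⟩
  simp

theorem sup (h : LocSub φ x) (h' : LocSub ψ x) : LocSub (fun y => φ y ⊔ ψ y) x := by
  refine ⟨h.usc.sup h'.usc, ?_⟩
  filter_upwards [h.submean, h'.submean] with ρ hρ hρ'
  have hi := hρ.1.sup hρ'.1
  refine ⟨hi, max_le (hρ.2.trans ?_) (hρ'.2.trans ?_)⟩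
  · exact integral_mono hρ.1 hi fun s => le_max_left _ _
  · exact integral_mono hρ'.1 hi fun s => le_max_right _ _

theorem sum {ι : Type*} [NeZero d] (t : Finset ι) {f : ι → Space d → ℝ}
    (h : ∀ i ∈ t, LocSub (f i) x) : LocSub (fun y => ∑ i ∈ t, f i y) x := by
  classical
  induction t using Finset.induction_on with
  | empty => simpa using const 0 x
  | insert a t ha ih =>
    simp only [Finset.sum_insert ha]
    exact (h a (by simp)).add (ih fun i hi => h i (by simp [hi]))

theorem const_mul {c : ℝ} (hc : 0 ≤ c) (h : LocSub φ x) : LocSub (fun y => c * φ y) x := by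
  refine ⟨?_, ?_⟩
  · have hcont : ContinuousAt (fun t : ℝ => c * t) (φ x) := by fun_prop
    exact hcont.comp_upperSemicontinuousAt h.usc fun a b hab => mul_le_mul_of_nonneg_left hab hc
  · filter_upwards [h.submean] with ρ hρ
    refine ⟨hρ.1.const_mul c, ?_⟩
    rw [integral_const_mul]
    exact mul_le_mul_of_nonneg_left hρ.2 hc

/-- The local sub-mean value property is invariant under isometries. -/
theorem comp_isometry (A : Space d ≃ₗᵢ[ℝ] Space d) (a b : Space d)
    (h : LocSub φ (a + A (x - b))) : LocSub (fun y => φ (a + A (y - b))) x := by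
  refine ⟨?_, ?_⟩
  · have hc : ContinuousAt (fun y => a + A (y - b)) x := by fun_prop
    exact fun c hc' => hc.eventually (h.usc c hc')
  · filter_upwards [h.submean] with ρ hρ
    have he : ∀ s : sphere (0 : Space d) 1, φ (a + A (x + ρ • (s : Space d) - b))
        = φ (a + A (x - b) + ρ • (sphereMap A s : Space d)) := by
      intro s
      congr 1
      simp only [sphereMap, map_sub, map_add, map_smul]
      abel
    simp only [he]
    refine ⟨?_, ?_⟩
    · exact (measurePreserving_sphereMap A).integrable_comp_of_integrable hρ.1
    · rw [integral_sphereMap A fun s => φ (a + A (x - b) + ρ • (s : Space d))]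
      exact hρ.2

end LocSub

theorem isClosed_setOf_le_of_upperSemicontinuousOn {K : Set (Space d)} (hK : IsClosed K)
    {φ : Space d → ℝ} (hφ : UpperSemicontinuousOn φ K) {c : ℝ} :
    IsClosed {x ∈ K | c ≤ φ x} := by
  rw [← isOpen_compl_iff, isOpen_iff_mem_nhds]
  intro x hx
  by_cases hxK : x ∈ K
  · have hlt : φ x < c := by
      by_contra! h
      exact hx ⟨hxK, h⟩
    filter_upwards [eventually_nhdsWithin_iff.1 (hφ x hxK c hlt)] with y hy h
    exact absurd (hy h.1) (not_lt.2 h.2)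
  · filter_upwards [hK.isOpen_compl.mem_nhds hxK] with y hy h
    exact hy h.1

/-- **Strong maximum principle.** If `φ ≤ M` on the open set `U` and the set where `φ` attains `M`
is closed in `ℝ^d` and misses a point, then it is empty: at the point of this set closest to the
missing point, `φ` would be less than `M` on a part of every small sphere. -/
theorem LocSub.lt_of_isClosed [NeZero d] {U : Set (Space d)} (hU : IsOpen U) {φ : Space d → ℝ}
    (hφ : ∀ x ∈ U, LocSub φ x) {M : ℝ} (hM : ∀ x ∈ U, φ x ≤ M)
    (hcl : IsClosed {x ∈ U | M ≤ φ x}) {p : Space d} (hp : p ∉ {x ∈ U | M ≤ φ x}) :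
    ∀ x ∈ U, φ x < M := by
  by_contra! hne
  obtain ⟨x₀, hx₀U, hx₀⟩ := hne
  set E := {x ∈ U | M ≤ φ x} with hE
  obtain ⟨x, hxE, hx⟩ := hcl.exists_infDist_eq_dist ⟨x₀, hx₀U, hx₀⟩ p
  have hmin : ∀ y ∈ E, dist x p ≤ dist y p := fun y hy => by
    rw [dist_comm x, dist_comm y, ← hx]
    exact infDist_le_dist_of_mem hy
  have hxp : 0 < ‖p - x‖ := by
    rw [norm_pos_iff, sub_ne_zero]
    rintro rfl
    exact hp hxE
  obtain ⟨ρ, ⟨⟨hint, hsub⟩, hρU⟩, hρ0, hρ⟩ := (((hφ x hxE.1).submean.and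
    (eventually_sphere_subset (hU.mem_nhds hxE.1))).and (Ioo_mem_nhdsGT hxp)).exists
  set W : Set (sphere (0 : Space d) 1) := {s | dist (x + ρ • (s : Space d)) p < dist x p} with hW
  have hWo : IsOpen W := isOpen_lt (by fun_prop) continuous_const
  have hWne : W.Nonempty := by
    refine ⟨⟨(‖p - x‖)⁻¹ • (p - x), by simp [norm_smul, hxp.ne']⟩, ?_⟩
    have h1 : x + ρ • ((‖p - x‖)⁻¹ • (p - x)) - p = (1 - ρ * (‖p - x‖)⁻¹) • (x - p) := by
      module
    have h2 : ρ * (‖p - x‖)⁻¹ < 1 := by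
      rw [← div_eq_mul_inv, div_lt_one hxp]; exact hρ
    have h3 : 0 < ρ * (‖p - x‖)⁻¹ := by positivity
    simp only [hW, mem_ofPred_eq]
    rw [dist_eq_norm, h1, norm_smul, dist_eq_norm, Real.norm_eq_abs, abs_of_pos (by linarith)]
    rw [norm_sub_rev] at hxp
    nlinarith
  have := integral_lt_of_le_of_lt_on_open hint (fun s => hM _ (hρU s)) hWo hWne fun s hs => by
    by_contra! hge
    exact absurd (hmin _ ⟨hρU s, hge⟩) (not_le.2 hs)
  linarith [hxE.2]

/-- **Maximum principle.** If `φ ≤ 0` on the open set `U` outside a compact subset of `U`, then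
`φ ≤ 0` on `U`. -/
theorem LocSub.nonpos_of_isCompact [NeZero d] {U C : Set (Space d)} (hU : IsOpen U)
    (hC : IsCompact C) (hCU : C ⊆ U) {φ : Space d → ℝ} (hφ : ∀ x ∈ U, LocSub φ x)
    (hsub : ∀ x ∈ U, 0 < φ x → x ∈ C) : ∀ x ∈ U, φ x ≤ 0 := by
  by_contra! hne
  obtain ⟨x₀, hx₀U, hx₀⟩ := hne
  have husc : UpperSemicontinuousOn φ C := fun x hx =>
    (hφ x (hCU hx)).usc.upperSemicontinuousWithinAt C
  obtain ⟨a, haC, ha⟩ := husc.exists_isMaxOn ⟨x₀, hsub x₀ hx₀U hx₀⟩ hC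
  have h0 : 0 < φ a := hx₀.trans_le (ha (hsub x₀ hx₀U hx₀))
  have hE : {x ∈ U | φ a ≤ φ x} = {x ∈ C | φ a ≤ φ x} := by
    ext x
    exact ⟨fun h => ⟨hsub x h.1 (h0.trans_le h.2), h.2⟩, fun h => ⟨hCU h.1, h.2⟩⟩
  have hcl : IsClosed {x ∈ C | φ a ≤ φ x} :=
    isClosed_setOf_le_of_upperSemicontinuousOn hC.isClosed husc
  have hne : ∃ p, p ∉ C := by
    by_contra! h
    exact noncompact_univ (Space d) (by rwa [eq_univ_of_forall h] at hC)
  obtain ⟨p, hp⟩ := hne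
  refine absurd (LocSub.lt_of_isClosed (M := φ a) hU hφ (fun x hx => ?_) (hE ▸ hcl) (p := p) ?_ a
    (hCU haC)) (lt_irrefl _)
  · by_contra! h
    exact absurd (ha (hsub x hx (h0.trans h))) (not_le.2 h)
  · rw [hE]
    exact fun h => hp h.1

/-- Let `v` vanish outside a compact set and have the local sub-mean value property in the open part
`U` of an unbounded closed set `K`. Then the supremum of `v` over `K` is attained at a point of
`K ∖ U`, and it is nonnegative. -/
theorem LocSub.exists_isMaxOn_diff [NeZero d] {U K C : Set (Space d)} (hU : IsOpen U) (hUK : U ⊆ K)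
    (hK : IsClosed K) (hKb : ¬ Bornology.IsBounded K) {p : Space d} (hp : p ∉ K)
    {v : Space d → ℝ} (hv : ∀ x ∈ U, LocSub v x) (husc : UpperSemicontinuousOn v K)
    (hC : IsCompact C) (hv0 : ∀ x ∈ K, x ∉ C → v x = 0) :
    ∃ y ∈ K \ U, 0 ≤ v y ∧ ∀ x ∈ K, v x ≤ v y := by
  obtain ⟨z, hzK, hzC⟩ : ∃ z ∈ K, z ∉ C := by
    by_contra! h
    exact hKb (hC.isBounded.subset h)
  have hcomp : IsCompact (insert z (K ∩ C)) := (hC.inter_left hK).insert z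
  have hsub : insert z (K ∩ C) ⊆ K := insert_subset hzK inter_subset_left
  obtain ⟨a, haC, ha⟩ := (husc.mono hsub).exists_isMaxOn ⟨z, mem_insert _ _⟩ hcomp
  have hz : v z = 0 := hv0 z hzK hzC
  have h0 : 0 ≤ v a := hz ▸ ha (mem_insert _ _)
  have hle : ∀ x ∈ K, v x ≤ v a := by
    intro x hx
    by_cases hxC : x ∈ C
    · exact ha (mem_insert_of_mem _ ⟨hx, hxC⟩)
    · rw [hv0 x hx hxC]; exact h0
  by_contra! hcon
  have hlt : ∀ y ∈ K \ U, v y < v a := by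
    intro y hy
    by_contra! hge
    obtain ⟨x, hx, hx'⟩ := hcon y hy (h0.trans hge)
    linarith [hle x hx]
  have hE : {x ∈ U | v a ≤ v x} = {x ∈ K | v a ≤ v x} := by
    ext x
    refine ⟨fun h => ⟨hUK h.1, h.2⟩, fun h => ⟨?_, h.2⟩⟩
    by_contra hxU
    exact absurd (hlt x ⟨h.1, hxU⟩) (not_lt.2 h.2)
  have hcl : IsClosed {x ∈ K | v a ≤ v x} := isClosed_setOf_le_of_upperSemicontinuousOn hK husc
  have haU : a ∈ U := (hE.symm ▸ ⟨hsub haC, le_rfl⟩ : a ∈ {x ∈ U | v a ≤ v x}).1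
  refine absurd (LocSub.lt_of_isClosed (M := v a) hU hv (fun x hx => hle x (hUK hx))
    (hE ▸ hcl) (p := p) ?_ a haU) (lt_irrefl _)
  exact fun h => hp (hUK h.1)

end

section

variable {d : ℕ}

/-! ### From extended real valued to real valued functions -/

theorem IsSubharmonicOn.congr {V u : Space d → EReal} {O Q : Set (Space d)}
    (h : IsSubharmonicOn u O) (hQ : IsOpen Q) (hQO : Q ⊆ O) (he : EqOn V u Q) :
    IsSubharmonicOn V Q := by
  refine ⟨hQ, fun x hx => he hx ▸ h.ne_top x (hQO hx), ?_, ?_⟩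
  · intro x hx c hc
    rw [he hx] at hc
    filter_upwards [(h.usc.mono hQO) x hx c hc, self_mem_nhdsWithin] with y hy hyQ
    rw [he hyQ]
    exact hy
  · intro x ρ hρ hb
    have hs : ∀ s : sphere (0 : Space d) 1, V (x + ρ • (s : Space d)) = u (x + ρ • (s : Space d)) :=
      fun s => he (hb (by simp [norm_smul, abs_of_pos hρ]))
    have hm : sphereMean V x ρ = sphereMean u x ρ := by simp only [sphereMean, hs]
    rw [hm, he (hb (mem_closedBall_self hρ.le))]
    exact h.submean x ρ hρ (hb.trans hQO)

theorem isSubharmonicOn_of_mem_sbh {V : Space d → EReal} {Q : Set (Space d)} (hQ : IsOpen Q)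
    (h : V ∈ sbh Q) : IsSubharmonicOn V Q := by
  obtain ⟨O, u, hQO, hu, he⟩ := h
  exact hu.congr hQ hQO he

/-- The truncation `max (V, -m)`, as a real function. -/
def trunc (m : ℝ) (V : Space d → EReal) (x : Space d) : ℝ := (max (V x) ((-m : ℝ) : EReal)).toReal

theorem coe_trunc {m : ℝ} {V : Space d → EReal} {x : Space d} (h : V x ≠ ⊤) :
    (trunc m V x : EReal) = max (V x) ((-m : ℝ) : EReal) := by
  refine EReal.coe_toReal ?_ ?_
  · rw [← lt_top_iff_ne_top]
    exact max_lt (lt_top_iff_ne_top.2 h) (EReal.coe_lt_top _)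
  · exact ((EReal.bot_lt_coe _).trans_le (le_max_right _ _)).ne'

theorem le_coe_trunc (m : ℝ) {V : Space d → EReal} {x : Space d} (h : V x ≠ ⊤) :
    V x ≤ trunc m V x := by
  rw [coe_trunc h]; exact le_max_left _ _

theorem neg_le_trunc {m : ℝ} {V : Space d → EReal} {x : Space d} (h : V x ≠ ⊤) :
    -m ≤ trunc m V x := by
  rw [← EReal.coe_le_coe_iff, coe_trunc h]; exact le_max_right _ _

theorem trunc_lt_iff {m c : ℝ} {V : Space d → EReal} {x : Space d} (h : V x ≠ ⊤) :
    trunc m V x < c ↔ V x < c ∧ -m < c := by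
  rw [← EReal.coe_lt_coe_iff, coe_trunc h, max_lt_iff, EReal.coe_lt_coe_iff]

theorem trunc_le_iff {m c : ℝ} {V : Space d → EReal} {x : Space d} (h : V x ≠ ⊤) :
    trunc m V x ≤ c ↔ V x ≤ c ∧ -m ≤ c := by
  rw [← EReal.coe_le_coe_iff, coe_trunc h, max_le_iff, EReal.coe_le_coe_iff]

theorem le_trunc_iff {m c : ℝ} {V : Space d → EReal} {x : Space d} (h : V x ≠ ⊤) (hc : -m < c) :
    c ≤ trunc m V x ↔ (c : EReal) ≤ V x := by
  rw [← not_lt, trunc_lt_iff h, not_and_or, not_lt, or_iff_left (not_not.2 hc)]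

theorem trunc_coe {m c : ℝ} {V : Space d → EReal} {x : Space d} (h : V x = c) :
    trunc m V x = max c (-m) := by
  rw [trunc, h, (EReal.coe_strictMono.monotone.map_max).symm, EReal.toReal_coe]

theorem IsSubharmonicOn.upperSemicontinuousOn_trunc {V : Space d → EReal} {O : Set (Space d)}
    (h : IsSubharmonicOn V O) (m : ℝ) : UpperSemicontinuousOn (trunc m V) O := by
  intro x hx c hc
  have hc' := (trunc_lt_iff (h.ne_top x hx)).1 hc
  filter_upwards [h.usc x hx c hc'.1, self_mem_nhdsWithin] with y hy hyO
  exact (trunc_lt_iff (h.ne_top y hyO)).2 ⟨hy, hc'.2⟩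

/-- A real function that is bounded and upper semicontinuous on a sphere is integrable over it. -/
theorem integrable_sphere_of_usc [NeZero d] {φ : Space d → ℝ} {x : Space d} {ρ m : ℝ} (hρ : 0 < ρ)
    (husc : UpperSemicontinuousOn φ (closedBall x ρ)) (hm : ∀ y ∈ closedBall x ρ, -m ≤ φ y) :
    Integrable (fun s : sphere (0 : Space d) 1 => φ (x + ρ • (s : Space d))) (sphereProb d) := by
  have hmem : ∀ s : sphere (0 : Space d) 1, x + ρ • (s : Space d) ∈ closedBall x ρ := fun s => by
    simp [norm_smul, abs_of_pos hρ]
  have hw : UpperSemicontinuous fun s : sphere (0 : Space d) 1 => φ (x + ρ • (s : Space d)) := by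
    intro s c hc
    have ht : Tendsto (fun s : sphere (0 : Space d) 1 => x + ρ • (s : Space d)) (𝓝 s)
        (𝓝[closedBall x ρ] (x + ρ • (s : Space d))) :=
      tendsto_nhdsWithin_iff.2 ⟨Continuous.tendsto (by fun_prop) s, Eventually.of_forall hmem⟩
    exact ht.eventually (husc _ (hmem s) c hc)
  obtain ⟨M, hM⟩ := husc.bddAbove_of_isCompact (isCompact_closedBall x ρ)
  refine Integrable.of_bound hw.measurable.aestronglyMeasurable (max |m| |M|)
    (Eventually.of_forall fun s => ?_)
  have h1 := hm _ (hmem s)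
  have h2 := hM (mem_image_of_mem φ (hmem s))
  rw [Real.norm_eq_abs, abs_le]
  constructor
  · linarith [le_abs_self m, le_max_left |m| |M|]
  · linarith [le_abs_self M, le_max_right |m| |M|]

theorem coe_integral_eq_sub {α : Type*} [MeasurableSpace α] {μ : Measure α} {f : α → ℝ}
    (hf : Integrable f μ) :
    ((∫ a, f a ∂μ : ℝ) : EReal) = ((∫⁻ a, ENNReal.ofReal (f a) ∂μ : ℝ≥0∞) : EReal)
      - ((∫⁻ a, ENNReal.ofReal (-f a) ∂μ : ℝ≥0∞) : EReal) := by
  have h1 : ∫⁻ a, ENNReal.ofReal (f a) ∂μ ≠ ⊤ := hf.lintegral_lt_top.ne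
  have h2 : ∫⁻ a, ENNReal.ofReal (-f a) ∂μ ≠ ⊤ := hf.neg.lintegral_lt_top.ne
  rw [integral_eq_lintegral_pos_part_sub_lintegral_neg_part hf, EReal.coe_sub,
    EReal.coe_ennreal_toReal h1, EReal.coe_ennreal_toReal h2]

theorem IsSubharmonicOn.submean_trunc [NeZero d] {V : Space d → EReal} {O : Set (Space d)}
    (h : IsSubharmonicOn V O) (m : ℝ) {x : Space d} {ρ : ℝ} (hρ : 0 < ρ)
    (hb : closedBall x ρ ⊆ O) :
    Integrable (fun s : sphere (0 : Space d) 1 => trunc m V (x + ρ • (s : Space d)))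
      (sphereProb d) ∧
    trunc m V x ≤ ∫ s : sphere (0 : Space d) 1, trunc m V (x + ρ • (s : Space d)) ∂(sphereProb d) :=
    by
  have hmem : ∀ s : sphere (0 : Space d) 1, x + ρ • (s : Space d) ∈ O := fun s => by
    apply hb; simp [norm_smul, abs_of_pos hρ]
  have hint := integrable_sphere_of_usc hρ ((h.upperSemicontinuousOn_trunc m).mono hb)
    fun y hy => neg_le_trunc (h.ne_top y (hb hy))
  refine ⟨hint, (trunc_le_iff (h.ne_top x (hb (mem_closedBall_self hρ.le)))).2 ⟨?_, ?_⟩⟩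
  · refine (h.submean x ρ hρ hb).trans ?_
    rw [coe_integral_eq_sub hint, sphereMean]
    refine EReal.sub_le_sub ?_ ?_
    · refine EReal.coe_ennreal_le_coe_ennreal_iff.2 (lintegral_mono fun s => ?_)
      rw [← EReal.real_coe_toENNReal]
      exact EReal.toENNReal_le_toENNReal (le_coe_trunc m (h.ne_top _ (hmem s)))
    · refine EReal.coe_ennreal_le_coe_ennreal_iff.2 (lintegral_mono fun s => ?_)
      rw [← EReal.real_coe_toENNReal, EReal.coe_neg]
      exact EReal.toENNReal_le_toENNReal
        (EReal.neg_le_neg_iff.2 (le_coe_trunc m (h.ne_top _ (hmem s))))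
  · have := integral_mono (integrable_const (-m)) hint
      fun s => neg_le_trunc (h.ne_top _ (hmem s))
    simpa using this

theorem IsSubharmonicOn.locSub_trunc [NeZero d] {V : Space d → EReal} {O : Set (Space d)}
    (h : IsSubharmonicOn V O) (m : ℝ) {x : Space d} (hx : x ∈ O) : LocSub (trunc m V) x := by
  have hO := h.isOpen.mem_nhds hx
  refine ⟨?_, ?_⟩
  · have := (h.upperSemicontinuousOn_trunc m) x hx
    rwa [SemicontinuousWithinAt, nhdsWithin_eq_nhds.2 hO] at this
  · filter_upwards [eventually_closedBall_subset hO, self_mem_nhdsWithin] with ρ hρ hρ0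
    exact h.submean_trunc m hρ0 hρ

/-- Real harmonic functions on an open set: continuous functions equal to their mean over every
sphere that bounds a ball in the set. -/
structure IsHarmonicReal (h : Space d → ℝ) (Ω : Set (Space d)) : Prop where
  cont : ContinuousOn h Ω
  mean : ∀ x ρ, 0 < ρ → closedBall x ρ ⊆ Ω →
    h x = ∫ s : sphere (0 : Space d) 1, h (x + ρ • (s : Space d)) ∂(sphereProb d)

theorem IsHarmonicReal.const_sub [NeZero d] {h : Space d → ℝ} {Ω : Set (Space d)}
    (hh : IsHarmonicReal h Ω) (c : ℝ) : IsHarmonicReal (fun x => c - h x) Ω := by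
  refine ⟨continuousOn_const.sub hh.cont, fun x ρ hρ hb => ?_⟩
  rw [integral_sub (integrable_const c), ← hh.mean x ρ hρ hb]
  · simp
  · refine integrable_of_continuous (hh.cont.comp_continuous (by fun_prop) fun s => hb ?_)
    simp [norm_smul, abs_of_pos hρ]

/-- A function from `har Ω` is finite on `Ω`. -/
theorem coe_toReal_of_har {V : Space d → EReal} {Ω : Set (Space d)} (hΩ : IsOpen Ω)
    (hV : V ∈ har Ω) {x : Space d} (hx : x ∈ Ω) : ((V x).toReal : EReal) = V x := by
  have h1 := isSubharmonicOn_of_mem_sbh hΩ hV.1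
  have h2 := isSubharmonicOn_of_mem_sbh hΩ hV.2
  refine EReal.coe_toReal (h1.ne_top x hx) fun h => h2.ne_top x hx ?_
  simp [h]

theorem isHarmonicReal_of_har [NeZero d] {V : Space d → EReal} {Ω : Set (Space d)} (hΩ : IsOpen Ω)
    (hV : V ∈ har Ω) : IsHarmonicReal (fun x => (V x).toReal) Ω := by
  have h1 := isSubharmonicOn_of_mem_sbh hΩ hV.1
  have h2 := isSubharmonicOn_of_mem_sbh hΩ hV.2
  have hc : ∀ x ∈ Ω, V x = ((V x).toReal : EReal) := fun x hx => (coe_toReal_of_har hΩ hV hx).symm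
  have hcont : ContinuousOn (fun x => (V x).toReal) Ω := by
    intro x hx
    rw [ContinuousWithinAt, tendsto_order]
    constructor
    · intro c hcx
      have : -V x < ((-c : ℝ) : EReal) := by
        rw [hc x hx, ← EReal.coe_neg, EReal.coe_lt_coe_iff]; linarith
      filter_upwards [h2.usc x hx _ this, self_mem_nhdsWithin] with y hy hyΩ
      rw [hc y hyΩ, ← EReal.coe_neg, EReal.coe_lt_coe_iff] at hy
      linarith
    · intro c hcx
      have : V x < (c : EReal) := by
        rw [hc x hx, EReal.coe_lt_coe_iff]; exact hcx
      filter_upwards [h1.usc x hx _ this, self_mem_nhdsWithin] with y hy hyΩ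
      rw [hc y hyΩ, EReal.coe_lt_coe_iff] at hy
      exact hy
  refine ⟨hcont, fun x ρ hρ hb => ?_⟩
  obtain ⟨m, hm⟩ := (isCompact_closedBall x ρ).exists_bound_of_continuousOn (hcont.mono hb)
  have ht1 : ∀ y ∈ closedBall x ρ, trunc m V y = (V y).toReal := fun y hy => by
    rw [trunc_coe (hc y (hb hy)), max_eq_left]
    exact (abs_le.1 (hm y hy)).1
  have ht2 : ∀ y ∈ closedBall x ρ, trunc m (fun z => -V z) y = -(V y).toReal := fun y hy => by
    have h3 : -V y = ((-(V y).toReal : ℝ) : EReal) := by rw [EReal.coe_neg, ← hc y (hb hy)]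
    rw [trunc_coe h3, max_eq_left]
    have := (abs_le.1 (hm y hy)).2
    linarith
  have hmem : ∀ s : sphere (0 : Space d) 1, x + ρ • (s : Space d) ∈ closedBall x ρ := fun s => by
    simp [norm_smul, abs_of_pos hρ]
  have hx := mem_closedBall_self (x := x) hρ.le
  have e1 := (h1.submean_trunc m hρ hb).2
  have e2 := (h2.submean_trunc m hρ hb).2
  simp only [ht1 _ hx, ht2 _ hx, ht1 _ (hmem _), ht2 _ (hmem _), integral_neg] at e1 e2
  linarith

/-- The truncation at level `-m` of a function on `D ∖ o`, continued by `0` to `ℝ^d`. -/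
def truncExt (m : ℝ) (D : Set (Space d)) (o : Space d) (V : Space d → EReal) : Space d → ℝ :=
  (D \ {o}).indicator (trunc m V)

theorem truncExt_eq_zero {m : ℝ} (hm : 0 ≤ m) {D T : Set (Space d)} {o : Space d}
    {V : Space d → EReal} (hT : ∀ x ∈ (D \ {o}) \ T, V x = 0) {x : Space d} (hx : x ∉ T) :
    truncExt m D o V x = 0 := by
  by_cases h : x ∈ D \ {o}
  · rw [truncExt, indicator_of_mem h, trunc_coe (c := 0) (by simpa using hT x ⟨h, hx⟩)]
    simpa using hm
  · rw [truncExt, indicator_of_notMem h]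

theorem locSub_truncExt [NeZero d] {m : ℝ} (hm : 0 ≤ m) {D T : Set (Space d)}
    {o : Space d} {V : Space d → EReal} (hV : IsSubharmonicOn V (D \ {o})) (hTD : closure T ⊆ D)
    (hT : ∀ x ∈ (D \ {o}) \ T, V x = 0) {x : Space d} (hx : x ≠ o) :
    LocSub (truncExt m D o V) x := by
  by_cases hxD : x ∈ D
  · refine (hV.locSub_trunc m ⟨hxD, hx⟩).congr ?_
    filter_upwards [hV.isOpen.mem_nhds ⟨hxD, hx⟩] with y hy
    rw [truncExt, indicator_of_mem hy]
  · refine (LocSub.const 0 x).congr ?_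
    filter_upwards [isClosed_closure.isOpen_compl.mem_nhds fun h => hxD (hTD h)] with y hy
    exact (truncExt_eq_zero hm hT fun h => hy (subset_closure h)).symm

end

section

variable {d : ℕ}

/-! ### Strictly subharmonic radial functions -/

/-- Second order Taylor expansion with Peano remainder, as a lower bound. -/
theorem eventually_taylor_two_le {F F₁ : ℝ → ℝ} {q b ε : ℝ}
    (hF : ∀ᶠ y in 𝓝 q, HasDerivAt F (F₁ y) y) (hF₁ : HasDerivAt F₁ b q) (hε : 0 < ε) :
    ∀ᶠ t in 𝓝 (0 : ℝ), F q + F₁ q * t + (b / 2 - ε) * t ^ 2 ≤ F (q + t) := by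
  have h1 := (hasDerivAt_iff_isLittleO.1 hF₁).def hε
  obtain ⟨η, hη, hball⟩ := Metric.eventually_nhds_iff_ball.1 (hF.and h1)
  filter_upwards [Metric.ball_mem_nhds (0 : ℝ) hη] with t ht
  have ht' : |t| < η := by simpa using ht
  have hsub : ∀ y ∈ uIcc q (q + t), y ∈ ball q η ∧ |y - q| ≤ |t| := by
    intro y hy
    have : |y - q| ≤ |t| := by simpa using abs_sub_left_of_mem_uIcc hy
    exact ⟨by rw [mem_ball, Real.dist_eq]; linarith, this⟩
  have h3 := Convex.norm_image_sub_le_of_norm_hasDerivWithin_le (𝕜 := ℝ)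
    (f := fun y => F y - F q - (F₁ q * (y - q) + b / 2 * (y - q) ^ 2))
    (f' := fun y => F₁ y - (F₁ q + b * (y - q))) (C := ε * |t|) (s := uIcc q (q + t))
    (x := q) (y := q + t) (fun y hy => ?_) (fun y hy => ?_) (convex_uIcc _ _) left_mem_uIcc
    right_mem_uIcc
  · simp only [sub_self, mul_zero, add_sub_cancel_left, Real.norm_eq_abs] at h3
    have h4 := (abs_le.1 h3).1
    have h5 : ε * |t| * |t| = ε * t ^ 2 := by rw [mul_assoc, ← sq, sq_abs]
    nlinarith
  · have h4 := (hball y (hsub y hy).1).1.hasDerivWithinAt (s := uIcc q (q + t))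
    have h5 : HasDerivAt (fun y => F₁ q * (y - q) + b / 2 * (y - q) ^ 2)
        (F₁ q + b * (y - q)) y := by
      have h6 := (hasDerivAt_id y).sub_const q
      convert! (h6.const_mul (F₁ q)).add ((h6.pow 2).const_mul (b / 2)) using 1
      simp; ring
    exact (h4.sub_const (F q)).sub h5.hasDerivWithinAt
  · have h4 := (hball y (hsub y hy).1).2
    rw [smul_eq_mul, mul_comm (y - q), sub_sub] at h4
    refine h4.trans ?_
    rw [Real.norm_eq_abs]
    exact mul_le_mul_of_nonneg_left (hsub y hy).2 hε.le

/-- The radial function `F (‖y - o‖²)` has Laplacian `4 q F'' + 2 d F'` where `q = ‖y - o‖²`. Where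
this is positive, the function satisfies the local sub-mean value property. -/
theorem locSub_radial [NeZero d] {F F₁ : ℝ → ℝ} {o x : Space d} {b : ℝ}
    (hF : ∀ᶠ y in 𝓝 (‖x - o‖ ^ 2), HasDerivAt F (F₁ y) y)
    (hF₁ : HasDerivAt F₁ b (‖x - o‖ ^ 2))
    (hpos : 0 < d * F₁ (‖x - o‖ ^ 2) + 2 * ‖x - o‖ ^ 2 * b) :
    LocSub (fun y => F (‖y - o‖ ^ 2)) x := by
  set q := ‖x - o‖ ^ 2 with hq
  have hq0 : 0 ≤ q := sq_nonneg _
  have hd : (0 : ℝ) < d := Nat.cast_pos.2 (NeZero.pos d)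
  have hnorm : ContinuousAt (fun y : Space d => ‖y - o‖ ^ 2) x := by fun_prop
  have hFc : ContinuousAt F q := hF.self_of_nhds.continuousAt
  refine ⟨(ContinuousAt.comp (f := fun y : Space d => ‖y - o‖ ^ 2) hFc hnorm).upperSemicontinuousAt,
    ?_⟩
  set κ := (d * F₁ q + 2 * q * b) / d with hκ
  have hκ0 : 0 < κ := by positivity
  set ε := κ * d / (8 * (q + 1)) with hε
  have hε0 : 0 < ε := by positivity
  have htend : Tendsto (fun y : Space d => ‖y - o‖ ^ 2 - q) (𝓝 x) (𝓝 0) := by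
    have : Tendsto (fun y : Space d => ‖y - o‖ ^ 2 - q) (𝓝 x) (𝓝 (‖x - o‖ ^ 2 - q)) :=
      (hnorm.sub continuousAt_const)
    simpa [hq] using this
  have hTay := eventually_sphere_subset (htend.eventually (eventually_taylor_two_le hF hF₁ hε0))
  have hcont := eventually_sphere_subset (hnorm.eventually hF)
  have hsmall : ∀ᶠ ρ : ℝ in 𝓝[>] 0, 0 ≤ κ / 2 + (b / 2 - ε) * ρ ^ 2 := by
    have : Tendsto (fun ρ : ℝ => κ / 2 + (b / 2 - ε) * ρ ^ 2) (𝓝[>] 0)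
        (𝓝 (κ / 2 + (b / 2 - ε) * 0 ^ 2)) :=
      (Continuous.tendsto (by fun_prop) 0).mono_left nhdsWithin_le_nhds
    refine (this.eventually (lt_mem_nhds (a := 0) ?_)).mono fun ρ h => h.le
    simpa using hκ0
  filter_upwards [hTay, hcont, hsmall, self_mem_nhdsWithin] with ρ hρT hρc hρs hρ0
  have hint : Integrable (fun s : sphere (0 : Space d) 1 => F (‖x + ρ • (s : Space d) - o‖ ^ 2))
      (sphereProb d) := by
    refine integrable_of_continuous (continuous_iff_continuousAt.2 fun s => ?_)
    exact ContinuousAt.comp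
      (f := fun s : sphere (0 : Space d) 1 => ‖x + ρ • (s : Space d) - o‖ ^ 2)
      (hρc s).continuousAt (by fun_prop)
  refine ⟨hint, ?_⟩
  have hexp : ∀ s : sphere (0 : Space d) 1, ‖x + ρ • (s : Space d) - o‖ ^ 2 - q
      = 2 * ρ * inner ℝ (x - o) (s : Space d) + ρ ^ 2 := by
    intro s
    have h1 : x + ρ • (s : Space d) - o = (x - o) + ρ • (s : Space d) := by abel
    rw [h1, norm_add_sq_real, inner_smul_right, norm_smul, ← hq]
    simp
    ring
  set g : sphere (0 : Space d) 1 → ℝ := fun s => inner ℝ (x - o) (s : Space d) with hg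
  have hgc : Continuous g := by fun_prop
  have hlow : ∀ s, F q + F₁ q * ρ ^ 2 + (b / 2 - ε) * ρ ^ 4
      + (2 * ρ * F₁ q + (b / 2 - ε) * 4 * ρ ^ 3) * g s + (b / 2 - ε) * 4 * ρ ^ 2 * g s ^ 2
      ≤ F (‖x + ρ • (s : Space d) - o‖ ^ 2) := by
    intro s
    have := hρT s
    rw [add_sub_cancel, hexp] at this
    refine le_trans (le_of_eq ?_) this
    simp only [hg]
    ring
  have hmono := integral_mono (integrable_of_continuous (by fun_prop)) hint hlow
  refine le_trans ?_ hmono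
  rw [integral_add (integrable_of_continuous (by fun_prop))
      (integrable_of_continuous (by fun_prop)),
    integral_add (integrable_of_continuous (by fun_prop)) (integrable_of_continuous (by fun_prop)),
    integral_const_mul, integral_const_mul, hg, integral_inner_sphere, integral_inner_sq_sphere,
    ← hq]
  simp only [integral_const, probReal_univ, one_smul, mul_zero, add_zero]
  have h1 : F₁ q + (b / 2) * 4 * (q / d) = κ := by
    rw [hκ]; field_simp; ring
  have h2 : ε * 4 * (q / d) ≤ κ / 2 := by
    rw [hε]
    have : κ * d / (8 * (q + 1)) * 4 * (q / d) = κ / 2 * (q / (q + 1)) := by field_simp; ring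
    rw [this]
    exact mul_le_of_le_one_right (by positivity) (by rw [div_le_one (by positivity)]; linarith)
  have h3 : 0 ≤ ρ ^ 2 * (κ / 2 + (b / 2 - ε) * ρ ^ 2) := by positivity
  have h4 : 0 ≤ ρ ^ 2 * (κ / 2 - ε * 4 * (q / d)) :=
    mul_nonneg (sq_nonneg _) (by linarith)
  calc F q ≤ F q + (ρ ^ 2 * (κ / 2 + (b / 2 - ε) * ρ ^ 2)
        + ρ ^ 2 * (κ / 2 - ε * 4 * (q / d))) := by linarith
    _ = _ := by rw [← h1]; ring

theorem norm_sub_sq_pos {o x : Space d} (hx : x ≠ o) : 0 < ‖x - o‖ ^ 2 :=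
  pow_pos (norm_pos_iff.2 (sub_ne_zero.2 hx)) 2

theorem locSub_log {o x : Space 2} (hx : x ≠ o) (c : ℝ) :
    LocSub (fun y => Real.log (‖y - o‖ ^ 2) + ‖y - o‖ ^ 2 - c) x := by
  have hq := norm_sub_sq_pos hx
  have hF₁ : HasDerivAt (fun t : ℝ => t⁻¹ + 1) (-((‖x - o‖ ^ 2) ^ 2)⁻¹) (‖x - o‖ ^ 2) :=
    (hasDerivAt_inv hq.ne').add_const 1
  refine locSub_radial (F := fun t => Real.log t + t - c) ?_ hF₁ ?_
  · filter_upwards [lt_mem_nhds hq] with y hy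
    exact ((Real.hasDerivAt_log hy.ne').add (hasDerivAt_id y)).sub_const c
  · have : ((2 : ℕ) : ℝ) * ((‖x - o‖ ^ 2)⁻¹ + 1)
        + 2 * ‖x - o‖ ^ 2 * -((‖x - o‖ ^ 2) ^ 2)⁻¹ = 2 := by
      push_cast
      field_simp
      ring
    rw [this]; norm_num

theorem locSub_rpow (hd : 3 ≤ d) {o x : Space d} (hx : x ≠ o) {δ : ℝ} (hδ : 0 < δ) (c : ℝ) :
    LocSub (fun y => -(2 * (‖y - o‖ ^ 2) ^ (-(((d : ℝ) - 2) / 2))) + δ * ‖y - o‖ ^ 2 - c) x := by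
  have : NeZero d := ⟨by omega⟩
  have hq := norm_sub_sq_pos hx
  set q := ‖x - o‖ ^ 2 with hqdef
  set α : ℝ := ((d : ℝ) - 2) / 2 with hα
  have hd' : (d : ℝ) = 2 * α + 2 := by rw [hα]; ring
  have hpow : ∀ (p y : ℝ), 0 < y → HasDerivAt (fun t : ℝ => t ^ p) (p * y ^ (p - 1)) y :=
    fun p y hy => Real.hasDerivAt_rpow_const (Or.inl hy.ne')
  have hF₁ : HasDerivAt (fun t : ℝ => 2 * α * t ^ (-α - 1) + δ)
      (2 * α * ((-α - 1) * q ^ (-α - 1 - 1))) q :=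
    ((hpow _ q hq).const_mul (2 * α)).add_const δ
  refine locSub_radial (F := fun t => -(2 * t ^ (-α)) + δ * t - c) ?_ hF₁ ?_
  · filter_upwards [lt_mem_nhds hq] with y hy
    convert! ((((hpow (-α) y hy).const_mul 2).neg.add ((hasDerivAt_id y).const_mul δ)).sub_const c)
      using 1
    ring
  · have h1 : q * q ^ (-α - 1 - 1) = q ^ (-α - 1) := by
      rw [mul_comm, ← Real.rpow_add_one hq.ne']; congr 1; ring
    have h2 : (d : ℝ) * (2 * α * q ^ (-α - 1) + δ)
        + 2 * q * (2 * α * ((-α - 1) * q ^ (-α - 1 - 1))) = d * δ := by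
      linear_combination (4 * α * (-α - 1)) * h1 + 2 * α * q ^ (-α - 1) * hd'
    rw [h2]
    have : (0 : ℝ) < d := Nat.cast_pos.2 (NeZero.pos d)
    positivity

end

section

variable {d : ℕ}

/-! ### The Harnack inequality -/

/-- Integration in polar coordinates. -/
theorem lintegral_eq_lintegral_polar [NeZero d] {g : Space d → ℝ≥0∞} (hg : Measurable g) :
    ∫⁻ y, g y = ∫⁻ ρ : Ioi (0 : ℝ), (∫⁻ s : sphere (0 : Space d) 1, g ((ρ : ℝ) • (s : Space d))
      ∂(volume : Measure (Space d)).toSphere)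
      ∂(Measure.volumeIoiPow (Module.finrank ℝ (Space d) - 1)) := by
  rw [← lintegral_prod_symm' (fun p : sphere (0 : Space d) 1 × Ioi (0 : ℝ) =>
      g ((p.2 : ℝ) • (p.1 : Space d))) (hg.comp (by fun_prop)),
    ← (volume : Measure (Space d)).measurePreserving_homeomorphUnitSphereProd.lintegral_comp_emb
      (Homeomorph.measurableEmbedding _)]
  have h1 : ∀ y : ({0}ᶜ : Set (Space d)),
      ((homeomorphUnitSphereProd (Space d) y).2 : ℝ)
        • ((homeomorphUnitSphereProd (Space d) y).1 : Space d) = y := by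
    intro y
    rw [← homeomorphUnitSphereProd_symm_apply_coe, Homeomorph.symm_apply_apply]
  simp only [h1]
  rw [lintegral_subtype_comap (measurableSet_singleton _).compl g, restrict_compl_singleton]

/-- If `f` has mean `m` over all spheres centred at `x` of radius less than `R`, then it has mean
`m` over the ball of radius `R`. -/
theorem lintegral_ball_eq [NeZero d] {f : Space d → ℝ≥0∞} (hf : Measurable f) {x : Space d}
    {R : ℝ} {m : ℝ≥0∞} (hm : ∀ ρ, 0 < ρ → ρ < R →
      ∫⁻ s : sphere (0 : Space d) 1, f (x + ρ • (s : Space d)) ∂(sphereProb d) = m) :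
    ∫⁻ y in ball x R, f y = m * volume (ball x R) := by
  have hball : ∀ g : Space d → ℝ≥0∞, ∫⁻ y in ball x R, g y
      = ∫⁻ y, (ball (0 : Space d) R).indicator (fun z => g (x + z)) y := by
    intro g
    rw [← lintegral_indicator measurableSet_ball]
    refine (lintegral_add_left_eq_self _ x).symm.trans ?_
    refine lintegral_congr fun y => ?_
    classical
    simp only [indicator_apply, mem_ball, dist_eq_norm, add_sub_cancel_left, sub_zero]
  have hmean : ∀ ρ, 0 < ρ → ρ < R → ∫⁻ s : sphere (0 : Space d) 1, f (x + ρ • (s : Space d))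
      ∂(volume : Measure (Space d)).toSphere
      = ∫⁻ _s : sphere (0 : Space d) 1, m ∂(volume : Measure (Space d)).toSphere := by
    intro ρ h0 hR
    rw [lintegral_const, ← hm ρ h0 hR, sphereProb, lintegral_smul_measure, smul_eq_mul, mul_comm,
      ← mul_assoc, ENNReal.mul_inv_cancel (Measure.measure_univ_ne_zero.2
        (Measure.toSphere_ne_zero _)) (measure_ne_top _ _), one_mul]
  rw [← setLIntegral_const, hball, hball, lintegral_eq_lintegral_polar
    (g := (ball (0 : Space d) R).indicator fun z => f (x + z))
    ((hf.comp (measurable_const_add x)).indicator measurableSet_ball), lintegral_eq_lintegral_polar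
    (measurable_const.indicator measurableSet_ball)]
  refine lintegral_congr fun ρ => ?_
  have hρ : (0 : ℝ) < ρ := ρ.2
  by_cases hR : (ρ : ℝ) < R
  · have hmem : ∀ s : sphere (0 : Space d) 1, (ρ : ℝ) • (s : Space d) ∈ ball (0 : Space d) R :=
      fun s => by simpa [norm_smul, abs_of_pos hρ] using hR
    simp only [indicator_of_mem (hmem _)]
    exact hmean ρ hρ hR
  · have hmem : ∀ s : sphere (0 : Space d) 1, (ρ : ℝ) • (s : Space d) ∉ ball (0 : Space d) R :=
      fun s => by simpa [norm_smul, abs_of_pos hρ] using hR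
    simp only [indicator_of_notMem (hmem _)]

/-- Harnack's inequality in a ball: the mean of `h` over a ball about `y` is at most `3 ^ d` times
its mean over a ball about `z` that contains the former and has three times its radius. -/
theorem IsHarmonicReal.le_mul_of_nonneg [NeZero d] {h : Space d → ℝ} {Ω : Set (Space d)}
    (hh : IsHarmonicReal h Ω) {x : Space d} {δ : ℝ} (hδ : 0 < δ) (hb : closedBall x (4 * δ) ⊆ Ω)
    (h0 : ∀ y ∈ closedBall x (4 * δ), 0 ≤ h y) {y z : Space d} (hy : y ∈ ball x δ)
    (hz : z ∈ ball x δ) : h y ≤ 3 ^ d * h z := by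
  set f : Space d → ℝ≥0∞ := (closedBall x (4 * δ)).indicator fun w => ENNReal.ofReal (h w) with hf
  have hfm : Measurable f := by
    have : ContinuousOn (fun w => ENNReal.ofReal (h w)) (closedBall x (4 * δ)) :=
      ENNReal.continuous_ofReal.comp_continuousOn (hh.cont.mono hb)
    classical
    rw [hf, ← piecewise_eq_indicator]
    exact this.measurable_piecewise continuousOn_const measurableSet_closedBall
  have hmean : ∀ w ∈ ball x δ, ∀ R ≤ 3 * δ, ∫⁻ v in ball w R, f v
      = ENNReal.ofReal (h w) * volume (ball w R) := by
    intro w hw R hR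
    refine lintegral_ball_eq hfm fun ρ hρ hρR => ?_
    have hsub : closedBall w ρ ⊆ closedBall x (4 * δ) :=
      closedBall_subset_closedBall' (by rw [mem_ball] at hw; linarith)
    have hmem : ∀ s : sphere (0 : Space d) 1, w + ρ • (s : Space d) ∈ closedBall x (4 * δ) :=
      fun s => hsub (by simp [norm_smul, abs_of_pos hρ])
    simp only [hf, indicator_of_mem (hmem _)]
    rw [hh.mean w ρ hρ (hsub.trans hb), ofReal_integral_eq_lintegral_ofReal]
    · exact integrable_of_continuous (hh.cont.comp_continuous (by fun_prop) fun s => hb (hmem s))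
    · exact Eventually.of_forall fun s => h0 _ (hmem s)
  have hsub : ball y δ ⊆ ball z (3 * δ) := by
    refine ball_subset_ball' ?_
    have := dist_triangle_right y z x
    rw [mem_ball] at hy hz
    linarith
  have hle := lintegral_mono_set (μ := volume) (f := f) hsub
  rw [hmean y hy δ (by linarith), hmean z hz _ le_rfl, Measure.addHaar_ball_mul_of_pos _ z
    (by norm_num : (0 : ℝ) < 3), Measure.addHaar_ball_center _ y,
    finrank_euclideanSpace_fin, ← mul_assoc] at hle
  have hz0 := h0 z (ball_subset_closedBall (ball_subset_ball (by linarith) hz))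
  have hle' := (ENNReal.mul_le_mul_iff_left (measure_ball_pos volume (0 : Space d) hδ).ne'
    measure_ball_lt_top.ne).1 hle
  rw [← ENNReal.ofReal_mul hz0, ENNReal.ofReal_le_ofReal_iff (by positivity)] at hle'
  linarith

/-- **Harnack's inequality** on a compact subset of a connected open set. Positivity of `h` is only
needed on a compact subset, so that functions with a singularity at the boundary are covered. -/
theorem exists_harnack [NeZero d] {Ω K : Set (Space d)} (hΩ : IsOpen Ω) (hΩc : IsPreconnected Ω)
    (hK : IsCompact K) (hKΩ : K ⊆ Ω) :
    ∃ L ⊆ Ω, IsCompact L ∧ ∃ C : ℝ, 0 ≤ C ∧ ∀ h : Space d → ℝ, IsHarmonicReal h Ω →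
      (∀ x ∈ L, 0 ≤ h x) → ∀ x ∈ K, ∀ y ∈ K, h x ≤ C * h y := by
  have hloc : ∀ x ∈ Ω, ∃ U ∈ 𝓝 x, ∃ L ⊆ Ω, IsCompact L ∧ U ⊆ L ∧ ∀ h : Space d → ℝ,
      IsHarmonicReal h Ω → (∀ x ∈ L, 0 ≤ h x) → ∀ y ∈ U, ∀ z ∈ U, h y ≤ 3 ^ d * h z := by
    intro x hx
    obtain ⟨ε, hε, hsub⟩ := Metric.isOpen_iff.1 hΩ x hx
    have hδ : 0 < ε / 8 := by positivity
    have hb : closedBall x (4 * (ε / 8)) ⊆ Ω :=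
      (closedBall_subset_ball (by linarith)).trans hsub
    exact ⟨ball x (ε / 8), ball_mem_nhds x hδ, _, hb, isCompact_closedBall _ _,
      (ball_subset_ball (by linarith)).trans ball_subset_closedBall,
      fun h hh h0 y hy z hz => hh.le_mul_of_nonneg hδ hb h0 hy hz⟩
  rcases K.eq_empty_or_nonempty with rfl | ⟨x₀, hx₀K⟩
  · exact ⟨∅, empty_subset _, isCompact_empty, 0, le_rfl, by simp⟩
  have hx₀ := hKΩ hx₀K
  have hchain : ∀ x ∈ Ω, ∃ L ⊆ Ω, IsCompact L ∧ ∃ C : ℝ, 0 ≤ C ∧ ∀ h : Space d → ℝ,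
      IsHarmonicReal h Ω → (∀ x ∈ L, 0 ≤ h x) → h x ≤ C * h x₀ ∧ h x₀ ≤ C * h x := by
    intro x hx
    refine hΩc.induction₂ (fun x y => ∃ L ⊆ Ω, IsCompact L ∧ ∃ C : ℝ, 0 ≤ C ∧ ∀ h : Space d → ℝ,
      IsHarmonicReal h Ω → (∀ x ∈ L, 0 ≤ h x) → h x ≤ C * h y ∧ h y ≤ C * h x) ?_ ?_ ?_ hx hx₀
    · intro x hx
      obtain ⟨U, hU, L, hLΩ, hL, -, hh⟩ := hloc x hx
      filter_upwards [mem_nhdsWithin_of_mem_nhds hU] with y hy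
      have hxU := mem_of_mem_nhds hU
      exact ⟨L, hLΩ, hL, 3 ^ d, by positivity, fun h h1 h2 =>
        ⟨hh h h1 h2 x hxU y hy, hh h h1 h2 y hy x hxU⟩⟩
    · rintro x y z - - - ⟨L, hLΩ, hL, C, hC, hh⟩ ⟨L', hLΩ', hL', C', hC', hh'⟩
      refine ⟨L ∪ L', union_subset hLΩ hLΩ', hL.union hL', C * C', by positivity,
        fun h h1 h2 => ?_⟩
      have e1 := hh h h1 fun x hx => h2 x (Or.inl hx)
      have e2 := hh' h h1 fun x hx => h2 x (Or.inr hx)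
      constructor
      · calc h x ≤ C * h y := e1.1
          _ ≤ C * (C' * h z) := mul_le_mul_of_nonneg_left e2.1 hC
          _ = C * C' * h z := by ring
      · calc h z ≤ C' * h y := e2.2
          _ ≤ C' * (C * h x) := mul_le_mul_of_nonneg_left e1.2 hC'
          _ = C * C' * h x := by ring
    · rintro x y - - ⟨L, hLΩ, hL, C, hC, hh⟩
      exact ⟨L, hLΩ, hL, C, hC, fun h h1 h2 => (hh h h1 h2).symm⟩
  have hcomp : ∃ L ⊆ Ω, IsCompact L ∧ K ⊆ L ∧ x₀ ∈ L ∧ ∃ C : ℝ, 0 ≤ C ∧ ∀ h : Space d → ℝ,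
      IsHarmonicReal h Ω → (∀ x ∈ L, 0 ≤ h x) → ∀ x ∈ K, h x ≤ C * h x₀ ∧ h x₀ ≤ C * h x := by
    refine hK.induction_on (p := fun K => ∃ L ⊆ Ω, IsCompact L ∧ K ⊆ L ∧ x₀ ∈ L ∧ ∃ C : ℝ, 0 ≤ C ∧
      ∀ h : Space d → ℝ, IsHarmonicReal h Ω → (∀ x ∈ L, 0 ≤ h x) →
        ∀ x ∈ K, h x ≤ C * h x₀ ∧ h x₀ ≤ C * h x) ?_ ?_ ?_ ?_
    · exact ⟨{x₀}, by simpa using hx₀, isCompact_singleton, empty_subset _, rfl, 0, le_rfl, by simp⟩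
    · rintro s t hst ⟨L, hLΩ, hL, hKL, hxL, C, hC, hh⟩
      exact ⟨L, hLΩ, hL, hst.trans hKL, hxL, C, hC, fun h h1 h2 x hx => hh h h1 h2 x (hst hx)⟩
    · rintro s t ⟨L, hLΩ, hL, hsL, hxL, C, hC, hh⟩ ⟨L', hLΩ', hL', hsL', hxL', C', hC', hh'⟩
      refine ⟨L ∪ L', union_subset hLΩ hLΩ', hL.union hL', union_subset_union hsL hsL',
        Or.inl hxL, C + C', by positivity, fun h h1 h2 x hx => ?_⟩
      have p0 := h2 x₀ (Or.inl hxL)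
      have px := h2 x (union_subset_union hsL hsL' hx)
      rcases hx with hx | hx
      · have e := hh h h1 (fun x hx => h2 x (Or.inl hx)) x hx
        constructor <;> nlinarith
      · have e := hh' h h1 (fun x hx => h2 x (Or.inr hx)) x hx
        constructor <;> nlinarith
    · intro x hx
      obtain ⟨U, hU, L, hLΩ, hL, hUL, hh⟩ := hloc x (hKΩ hx)
      obtain ⟨L', hLΩ', hL', C, hC, hh'⟩ := hchain x (hKΩ hx)
      refine ⟨U, mem_nhdsWithin_of_mem_nhds hU, insert x₀ (L ∪ L'),
        insert_subset hx₀ (union_subset hLΩ hLΩ'), (hL.union hL').insert x₀,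
        (hUL.trans subset_union_left).trans (subset_insert _ _), mem_insert _ _, C * 3 ^ d,
        by positivity, fun h h1 h2 y hy => ?_⟩
      have e1 := hh' h h1 fun x hx => h2 x (Or.inr (Or.inr hx))
      have e2 := hh h h1 fun x hx => h2 x (Or.inr (Or.inl hx))
      have hxU := mem_of_mem_nhds hU
      constructor
      · calc h y ≤ 3 ^ d * h x := e2 y hy x hxU
          _ ≤ 3 ^ d * (C * h x₀) := mul_le_mul_of_nonneg_left e1.1 (by positivity)
          _ = C * 3 ^ d * h x₀ := by ring
      · calc h x₀ ≤ C * h x := e1.2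
          _ ≤ C * (3 ^ d * h y) := mul_le_mul_of_nonneg_left (e2 x hxU y hy) hC
          _ = C * 3 ^ d * h y := by ring
  obtain ⟨L, hLΩ, hL, -, -, C, hC, hh⟩ := hcomp
  refine ⟨L, hLΩ, hL, C * C, by positivity, fun h h1 h2 x hx y hy => ?_⟩
  calc h x ≤ C * h x₀ := (hh h h1 h2 x hx).1
    _ ≤ C * (C * h y) := mul_le_mul_of_nonneg_left (hh h h1 h2 y hy).2 hC
    _ = C * C * h y := by ring

end

section

/-! ### From local to global sub-mean values in the plane -/

/-- The rotation of the plane by the angle `θ`. -/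
def planeRotation (θ : ℝ) : Space 2 ≃ₗᵢ[ℝ] Space 2 :=
  Complex.orthonormalBasisOneI.repr.symm.trans
    ((rotation (Circle.exp θ)).trans Complex.orthonormalBasisOneI.repr)

theorem planeRotation_apply (θ : ℝ) (x : Space 2) :
    planeRotation θ x = Complex.orthonormalBasisOneI.repr
      (Circle.exp θ * Complex.orthonormalBasisOneI.repr.symm x) := rfl

theorem planeRotation_add (α β : ℝ) (x : Space 2) :
    planeRotation (α + β) x = planeRotation α (planeRotation β x) := by
  simp only [planeRotation_apply, LinearIsometryEquiv.symm_apply_apply, Circle.exp_add,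
    Circle.coe_mul, mul_assoc]

theorem planeRotation_zero (x : Space 2) : planeRotation 0 x = x := by
  rw [planeRotation_apply, Circle.exp_zero, Circle.coe_one, one_mul,
    LinearIsometryEquiv.apply_symm_apply]

theorem planeRotation_two_pi (x : Space 2) : planeRotation (2 * Real.pi) x = x := by
  rw [planeRotation_apply, Circle.exp_two_pi, Circle.coe_one, one_mul,
    LinearIsometryEquiv.apply_symm_apply]

theorem norm_circle_exp_sub_le (α β : ℝ) :
    ‖(Circle.exp α : ℂ) - Circle.exp β‖ ≤ |α - β| := by
  have h : (Circle.exp α : ℂ) - Circle.exp β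
      = Circle.exp β * (Complex.exp (Complex.I * ((α - β : ℝ) : ℂ)) - 1) := by
    rw [mul_sub, mul_one, Circle.coe_exp, Circle.coe_exp, ← Complex.exp_add]
    congr 2
    push_cast
    ring
  rw [h, norm_mul, Circle.norm_coe, one_mul]
  exact Real.norm_exp_I_mul_ofReal_sub_one_le

/-- The multiples of the angle `θ` rotate a given unit vector to within `θ` of any other one. -/
theorem exists_norm_planeRotation_sub_le {θ : ℝ} (hθ : 0 < θ) (s t : sphere (0 : Space 2) 1) :
    ∃ k : ℕ, ‖planeRotation (k * θ) s - t‖ ≤ θ := by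
  set e := Complex.orthonormalBasisOneI.repr with he
  have hz : ‖e.symm (s : Space 2)‖ = 1 := by simp
  have hw : ‖e.symm (t : Space 2)‖ = 1 := by simp
  have hz0 : e.symm (s : Space 2) ≠ 0 := by
    intro h; rw [h] at hz; simp at hz
  obtain ⟨x, hx⟩ := Circle.exp_surjective
    ⟨e.symm (t : Space 2) / e.symm (s : Space 2), by
      simp [Submonoid.unitSphere, hz, hw]⟩
  set n : ℤ := ⌈|x|⌉ with hn
  set α := x + n * (2 * Real.pi) with hα
  have hα0 : 0 ≤ α := by
    have h1 : |x| ≤ n := Int.le_ceil _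
    have h2 := neg_abs_le x
    have h3 := Real.pi_gt_three
    nlinarith [abs_nonneg x]
  have hexp : (Circle.exp α : ℂ) * e.symm (s : Space 2) = e.symm (t : Space 2) := by
    rw [hα, Circle.exp_add, Circle.exp_int_mul_two_pi, mul_one, hx]
    exact div_mul_cancel₀ _ hz0
  refine ⟨⌊α / θ⌋₊, ?_⟩
  have h1 : planeRotation (⌊α / θ⌋₊ * θ) s - (t : Space 2)
      = e (((Circle.exp (⌊α / θ⌋₊ * θ) : ℂ) - Circle.exp α) * e.symm (s : Space 2)) := by
    rw [planeRotation_apply, sub_mul, hexp, map_sub, LinearIsometryEquiv.apply_symm_apply]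
  rw [h1, LinearIsometryEquiv.norm_map, norm_mul, hz, mul_one]
  refine (norm_circle_exp_sub_le _ _).trans ?_
  have h2 := Nat.floor_le (div_nonneg hα0 hθ.le)
  have h3 := Nat.lt_floor_add_one (α / θ)
  rw [le_div_iff₀ hθ] at h2
  rw [div_lt_iff₀ hθ] at h3
  rw [abs_le]
  constructor <;> linarith

/-- The average of a function over the orbit of the rotation by `2π / N` about `x`. -/
def rotationAverage (N : ℕ) (x : Space 2) (G : Space 2 → ℝ) (y : Space 2) : ℝ :=
  (N : ℝ)⁻¹ * ∑ k ∈ Finset.range N, G (x + planeRotation (k * (2 * Real.pi / N)) (y - x))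

theorem rotationAverage_self {N : ℕ} (hN : 0 < N) (x : Space 2) (G : Space 2 → ℝ) :
    rotationAverage N x G x = G x := by
  have : (N : ℝ) ≠ 0 := by positivity
  simp [rotationAverage, this]

/-- The average over `N` rotations of a Lipschitz function on the circle differs little from its
mean: it is invariant under the rotations, whose orbits are `2π / N`-dense. -/
theorem sum_planeRotation_le {N : ℕ} (hN : 0 < N) {φ : sphere (0 : Space 2) 1 → ℝ} {c : ℝ}
    (hc : 0 ≤ c) (hφ : ∀ s t, φ s - φ t ≤ c * dist s t) (s : sphere (0 : Space 2) 1) :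
    (N : ℝ)⁻¹ * ∑ k ∈ Finset.range N,
        φ (sphereMap (planeRotation (k * (2 * Real.pi / N))) s)
      ≤ ∫ t, φ t ∂(sphereProb 2) + c * (2 * Real.pi / N) := by
  have hN' : (0 : ℝ) < N := by positivity
  set θ := 2 * Real.pi / N with hθ
  have hθ0 : 0 < θ := by have := Real.pi_pos; positivity
  have hφc : Continuous φ := by
    have : LipschitzWith c.toNNReal φ := by
      refine LipschitzWith.of_le_add_mul _ fun s t => ?_
      rw [Real.coe_toNNReal c hc]
      linarith [hφ s t]
    exact this.continuous
  set A : sphere (0 : Space 2) 1 → ℝ := fun s =>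
    (N : ℝ)⁻¹ * ∑ k ∈ Finset.range N, φ (sphereMap (planeRotation (k * θ)) s) with hA
  have hcomp : ∀ α β s, sphereMap (planeRotation α) (sphereMap (planeRotation β) s)
      = sphereMap (planeRotation (α + β)) s := fun α β s =>
    Subtype.ext (planeRotation_add α β s).symm
  have hstep : ∀ s, A (sphereMap (planeRotation θ) s) = A s := by
    intro s
    have h1 : ∀ k : ℕ, φ (sphereMap (planeRotation (k * θ)) (sphereMap (planeRotation θ) s))
        = φ (sphereMap (planeRotation ((k + 1 : ℕ) * θ)) s) := fun k => by
      rw [hcomp]; congr 3; push_cast; ring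
    have h2 := Finset.sum_range_succ' (fun k => φ (sphereMap (planeRotation ((k : ℕ) * θ)) s)) N
    rw [Finset.sum_range_succ] at h2
    have h3 : φ (sphereMap (planeRotation (N * θ)) s)
        = φ (sphereMap (planeRotation ((0 : ℕ) * θ)) s) := by
      congr 1
      apply Subtype.ext
      have : N * θ = 2 * Real.pi := by rw [hθ]; field_simp
      simp only [sphereMap, this, planeRotation_two_pi, Nat.cast_zero, zero_mul,
        planeRotation_zero]
    simp only [hA, h1]
    congr 1
    linarith
  have hiter : ∀ (k : ℕ) s, A (sphereMap (planeRotation (k * θ)) s) = A s := by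
    intro k s
    induction k with
    | zero =>
      congr 1
      apply Subtype.ext
      simp [sphereMap, planeRotation_zero]
    | succ k ih =>
      have : ((k + 1 : ℕ) : ℝ) * θ = θ + k * θ := by push_cast; ring
      rw [this, ← hcomp, hstep, ih]
  have hlip : ∀ s t, A s - A t ≤ c * dist s t := by
    intro s t
    have h1 : ∀ k ∈ Finset.range N, φ (sphereMap (planeRotation (k * θ)) s)
        - φ (sphereMap (planeRotation (k * θ)) t) ≤ c * dist s t := by
      intro k _
      refine (hφ _ _).trans_eq ?_
      simp [Subtype.dist_eq, sphereMap]
    have h2 := Finset.sum_le_sum h1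
    rw [Finset.sum_sub_distrib, Finset.sum_const, Finset.card_range, nsmul_eq_mul] at h2
    calc A s - A t = (N : ℝ)⁻¹ * (∑ k ∈ Finset.range N, φ (sphereMap (planeRotation (k * θ)) s)
          - ∑ k ∈ Finset.range N, φ (sphereMap (planeRotation (k * θ)) t)) := by
          simp only [hA]; ring
      _ ≤ (N : ℝ)⁻¹ * (N * (c * dist s t)) := mul_le_mul_of_nonneg_left h2 (by positivity)
      _ = c * dist s t := by field_simp
  have hosc : ∀ t, A s ≤ A t + c * θ := by
    intro t
    obtain ⟨k, hk⟩ := exists_norm_planeRotation_sub_le hθ0 s t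
    have h1 := hlip (sphereMap (planeRotation (k * θ)) s) t
    rw [hiter, Subtype.dist_eq, dist_eq_norm] at h1
    have h2 := mul_le_mul_of_nonneg_left hk hc
    simp only [sphereMap] at h1
    linarith
  have hφk : ∀ k : ℕ, Continuous fun t => φ (sphereMap (planeRotation (k * θ)) t) := fun k =>
    hφc.comp (continuous_sphereMap _)
  have hAc : Continuous A := continuous_const.mul (continuous_finsetSum _ fun k _ => hφk k)
  have hAint : ∫ t, A t ∂(sphereProb 2) = ∫ t, φ t ∂(sphereProb 2) := by
    simp only [hA]
    rw [integral_const_mul, integral_finsetSum _ fun k _ => integrable_of_continuous (hφk k)]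
    simp only [integral_sphereMap, Finset.sum_const, Finset.card_range, nsmul_eq_mul]
    field_simp
  have hmono := integral_mono (integrable_const (A s))
    ((integrable_of_continuous hAc).add (integrable_const (c * θ))) hosc
  rw [integral_add' (integrable_of_continuous hAc) (integrable_const _), hAint] at hmono
  simpa using hmono

/-- A function with the local sub-mean value property is at most the mean of any Lipschitz majorant
of its boundary values on a circle: its averages over finitely many rotations about the centre
are dominated on the circle by almost constant functions. -/
theorem LocSub.le_integral_of_lipschitz {G : Space 2 → ℝ} (hG : ∀ x, LocSub G x) {x : Space 2}
    {ρ : ℝ} (hρ : 0 < ρ) {φ : sphere (0 : Space 2) 1 → ℝ} {c : ℝ}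
    (hc : 0 ≤ c) (hφ : ∀ s t, φ s - φ t ≤ c * dist s t)
    (hGφ : ∀ s : sphere (0 : Space 2) 1, G (x + ρ • (s : Space 2)) ≤ φ s) :
    G x ≤ ∫ t, φ t ∂(sphereProb 2) := by
  -- `ε` makes the set where the average exceeds its boundary bound compact in the open disc
  have hbound : ∀ N : ℕ, 0 < N → ∀ ε > 0,
      G x ≤ ∫ t, φ t ∂(sphereProb 2) + c * (2 * Real.pi / N) + ε := by
    intro N hN ε hε
    set b := ∫ t, φ t ∂(sphereProb 2) + c * (2 * Real.pi / N) with hb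
    have hM : ∀ y, LocSub (rotationAverage N x G) y := fun y =>
      LocSub.const_mul (by positivity)
        (LocSub.sum _ fun k _ => LocSub.comp_isometry _ x x (hG _))
    have hsph : ∀ y ∈ sphere x ρ, rotationAverage N x G y ≤ b := by
      intro y hy
      have hy' : ‖y - x‖ = ρ := by rwa [← dist_eq_norm]
      set s : sphere (0 : Space 2) 1 := ⟨ρ⁻¹ • (y - x), by
        simp [norm_smul, hy', abs_of_pos hρ, hρ.ne']⟩ with hs
      refine le_trans ?_ (sum_planeRotation_le hN hc hφ s)
      refine mul_le_mul_of_nonneg_left (Finset.sum_le_sum fun k _ => ?_) (by positivity)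
      refine le_trans (le_of_eq ?_) (hGφ _)
      simp only [sphereMap, hs, map_smul, smul_smul]
      rw [mul_inv_cancel₀ hρ.ne', one_smul]
    have husc : UpperSemicontinuousOn (rotationAverage N x G) (closedBall x ρ) := fun y _ =>
      (hM y).usc.upperSemicontinuousWithinAt _
    have hcl := isClosed_setOf_le_of_upperSemicontinuousOn isClosed_closedBall husc (c := b + ε)
    have hcomp : IsCompact {y ∈ closedBall x ρ | b + ε ≤ rotationAverage N x G y} :=
      (isCompact_closedBall x ρ).of_isClosed_subset hcl fun y hy => hy.1
    have := LocSub.nonpos_of_isCompact (φ := fun y => rotationAverage N x G y + -(b + ε))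
      (isOpen_ball (x := x) (ε := ρ)) hcomp ?_ (fun y _ => (hM y).add (LocSub.const _ y))
      (fun y hy h => ⟨ball_subset_closedBall hy, by linarith⟩) x (mem_ball_self hρ)
    · rw [rotationAverage_self hN] at this
      linarith
    · intro y hy
      rw [mem_ball]
      refine lt_of_le_of_ne hy.1 fun h => ?_
      linarith [hsph y h, hy.2]
  have hlim : Tendsto (fun N : ℕ => ∫ t, φ t ∂(sphereProb 2) + c * (2 * Real.pi / N) + 1 / N)
      atTop (𝓝 (∫ t, φ t ∂(sphereProb 2) + c * 0 + 0)) :=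
    ((tendsto_const_div_atTop_nhds_zero_nat _).const_mul c |>.const_add _).add
      (tendsto_const_div_atTop_nhds_zero_nat 1)
  simp only [mul_zero, add_zero] at hlim
  refine ge_of_tendsto hlim ?_
  filter_upwards [eventually_gt_atTop 0] with N hN
  exact hbound N hN _ (by positivity)

/-- The sup-convolution of `f` with a cone of slope `n`, a Lipschitz majorant of `f`. -/
def supConv {X : Type*} [PseudoMetricSpace X] (n : ℕ) (f : X → ℝ) (s : X) : ℝ :=
  ⨆ t, (f t - n * dist s t)

section supConv

variable {X : Type*} [PseudoMetricSpace X] {f : X → ℝ} {M : ℝ}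

theorem bddAbove_supConv (hf : ∀ t, f t ≤ M) (n : ℕ) (s : X) :
    BddAbove (range fun t => f t - n * dist s t) := by
  refine ⟨M, ?_⟩
  rintro _ ⟨t, rfl⟩
  have : 0 ≤ (n : ℝ) * dist s t := by positivity
  linarith [hf t]

theorem le_supConv (hf : ∀ t, f t ≤ M) (n : ℕ) (s : X) : f s ≤ supConv n f s := by
  have := le_ciSup (bddAbove_supConv hf n s) s
  simpa [supConv] using this

theorem supConv_le (hf : ∀ t, f t ≤ M) (n : ℕ) (s : X) : supConv n f s ≤ M := by
  have : Nonempty X := ⟨s⟩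
  refine ciSup_le fun t => ?_
  have : 0 ≤ (n : ℝ) * dist s t := by positivity
  linarith [hf t]

theorem supConv_sub_le (hf : ∀ t, f t ≤ M) (n : ℕ) (s s' : X) :
    supConv n f s - supConv n f s' ≤ n * dist s s' := by
  have : Nonempty X := ⟨s⟩
  rw [sub_le_iff_le_add]
  refine ciSup_le fun t => ?_
  have h1 := le_ciSup (bddAbove_supConv hf n s') t
  have h2 : (n : ℝ) * dist s' t ≤ n * dist s s' + n * dist s t := by
    rw [← mul_add]
    exact mul_le_mul_of_nonneg_left (dist_comm s s' ▸ dist_triangle s' s t) n.cast_nonneg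
  simp only [supConv]
  linarith

theorem tendsto_supConv (hf : ∀ t, f t ≤ M) (husc : UpperSemicontinuous f) (s : X) :
    Tendsto (fun n => supConv n f s) atTop (𝓝 (f s)) := by
  have : Nonempty X := ⟨s⟩
  rw [tendsto_order]
  refine ⟨fun c hc => Eventually.of_forall fun n => hc.trans_le (le_supConv hf n s),
    fun c hc => ?_⟩
  obtain ⟨c', hc', hc'c⟩ := exists_between hc
  obtain ⟨η, hη, hball⟩ := Metric.eventually_nhds_iff.1 (husc s c' hc')
  obtain ⟨n₀, hn₀⟩ := exists_nat_ge ((M - c') / η)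
  filter_upwards [eventually_ge_atTop n₀] with n hn
  refine lt_of_le_of_lt (ciSup_le fun t => ?_) hc'c
  by_cases ht : dist t s < η
  · have h1 : f t < c' := hball ht
    have : 0 ≤ (n : ℝ) * dist s t := by positivity
    linarith
  · rw [div_le_iff₀ hη] at hn₀
    have h1 : (n₀ : ℝ) * η ≤ n * dist s t :=
      mul_le_mul (by exact_mod_cast hn) (by rw [dist_comm]; linarith) hη.le n.cast_nonneg
    linarith [hf t]

end supConv

/-- In the plane, the local sub-mean value property implies the sub-mean value inequality for all
circles. -/
theorem LocSub.le_integral {G : Space 2 → ℝ} (hG : ∀ x, LocSub G x) {m : ℝ} (hm : ∀ y, -m ≤ G y)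
    {x : Space 2} {ρ : ℝ} (hρ : 0 < ρ) :
    G x ≤ ∫ s : sphere (0 : Space 2) 1, G (x + ρ • (s : Space 2)) ∂(sphereProb 2) := by
  have husc : UpperSemicontinuous G := fun y => (hG y).usc
  set f : sphere (0 : Space 2) 1 → ℝ := fun s => G (x + ρ • (s : Space 2)) with hf
  have hfusc : UpperSemicontinuous f := fun s c hc =>
    (Continuous.tendsto (by fun_prop : Continuous fun s : sphere (0 : Space 2) 1 =>
      x + ρ • (s : Space 2)) s).eventually (husc _ c hc)
  obtain ⟨M, hM⟩ := (husc.upperSemicontinuousOn _).bddAbove_of_isCompact (isCompact_closedBall x ρ)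
  have hfM : ∀ s, f s ≤ M := fun s =>
    hM (mem_image_of_mem G (by simp [norm_smul, abs_of_pos hρ]))
  have hle : ∀ n, G x ≤ ∫ s, supConv n f s ∂(sphereProb 2) := fun n =>
    LocSub.le_integral_of_lipschitz hG hρ n.cast_nonneg (supConv_sub_le hfM n)
      fun s => le_supConv hfM n s
  have hcont : ∀ n, Continuous (supConv n f) := fun n => by
    have : LipschitzWith (n : NNReal) (supConv n f) := by
      refine LipschitzWith.of_le_add_mul _ fun s t => ?_
      have := supConv_sub_le hfM n s t
      simp only [NNReal.coe_natCast]
      linarith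
    exact this.continuous
  have hlim : Tendsto (fun n => ∫ s, supConv n f s ∂(sphereProb 2)) atTop
      (𝓝 (∫ s, f s ∂(sphereProb 2))) := by
    refine tendsto_integral_of_dominated_convergence (fun _ => max |m| |M|)
      (fun n => (hcont n).aestronglyMeasurable) (integrable_const _)
      (fun n => Eventually.of_forall fun s => ?_)
      (Eventually.of_forall fun s => tendsto_supConv hfM hfusc s)
    have h1 := supConv_le hfM n s
    have h2 := le_supConv hfM n s
    have h3 := hm (x + ρ • (s : Space 2))
    rw [Real.norm_eq_abs, abs_le]
    constructor
    · linarith [le_abs_self m, le_max_left |m| |M|]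
    · linarith [le_abs_self M, le_max_right |m| |M|]
  exact ge_of_tendsto' hlim hle

end

section

/-! ### A series of subharmonic functions in the plane -/

theorem toENNReal_coe_sub_add {b : ℝ} (hb : 0 ≤ b) (F : ℝ≥0∞) :
    ((b : EReal) - (F : EReal)).toENNReal + F = (-((b : EReal) - (F : EReal))).toENNReal
      + ENNReal.ofReal b := by
  induction F with
  | top => simp
  | coe f =>
    have h1 : (((f : ℝ≥0∞)) : EReal) = ((f : ℝ) : EReal) := rfl
    have h2 : (f : ℝ≥0∞) = ENNReal.ofReal (f : ℝ) := by simp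
    rw [h1, ← EReal.coe_sub, ← EReal.coe_neg, EReal.real_coe_toENNReal, EReal.real_coe_toENNReal,
      h2]
    rcases le_total b f with h | h
    · rw [ENNReal.ofReal_of_nonpos (by linarith), zero_add, ← ENNReal.ofReal_add (by linarith) hb]
      congr 1; ring
    · rw [ENNReal.ofReal_of_nonpos (p := -(b - f)) (by linarith), zero_add,
        ← ENNReal.ofReal_add (by linarith) (NNReal.coe_nonneg f)]
      congr 1; ring

/-- The sub-mean value inequality for `b - F` with `b` real and `F` possibly infinite, from an
inequality between integrals of nonnegative functions. -/
theorem coe_sub_le_sphereMean {d : ℕ} [NeZero d] {b : Space d → ℝ} (hb : Continuous b)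
    (hb0 : ∀ y, 0 ≤ b y) {F : Space d → ℝ≥0∞} (hF : Measurable F) {x : Space d} {ρ : ℝ}
    (h : ENNReal.ofReal (b x) + ∫⁻ s : sphere (0 : Space d) 1, F (x + ρ • (s : Space d))
        ∂(sphereProb d)
      ≤ ∫⁻ s : sphere (0 : Space d) 1, ENNReal.ofReal (b (x + ρ • (s : Space d))) ∂(sphereProb d)
        + F x) :
    (b x : EReal) - (F x : EReal) ≤ sphereMean (fun y => (b y : EReal) - (F y : EReal)) x ρ := by
  by_cases hFx : F x = ⊤
  · simp [hFx]
  set Φ := ∫⁻ s : sphere (0 : Space d) 1, F (x + ρ • (s : Space d)) ∂(sphereProb d)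
  set β := ∫⁻ s : sphere (0 : Space d) 1, ENNReal.ofReal (b (x + ρ • (s : Space d))) ∂(sphereProb d)
  set p := ∫⁻ s : sphere (0 : Space d) 1, ((b (x + ρ • (s : Space d)) : EReal)
    - (F (x + ρ • (s : Space d)) : EReal)).toENNReal ∂(sphereProb d) with hp
  set n := ∫⁻ s : sphere (0 : Space d) 1, (-((b (x + ρ • (s : Space d)) : EReal)
    - (F (x + ρ • (s : Space d)) : EReal))).toENNReal ∂(sphereProb d) with hn
  have hbm : Measurable fun s : sphere (0 : Space d) 1 =>
      ENNReal.ofReal (b (x + ρ • (s : Space d))) :=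
    (Continuous.measurable (by fun_prop)).ennreal_ofReal
  have hFm : Measurable fun s : sphere (0 : Space d) 1 => F (x + ρ • (s : Space d)) :=
    hF.comp (Continuous.measurable (by fun_prop))
  have hβ : β ≠ ⊤ := (integrable_of_continuous
    (f := fun s : sphere (0 : Space d) 1 => b (x + ρ • (s : Space d)))
      (by fun_prop)).lintegral_lt_top.ne
  have hΦ : Φ ≠ ⊤ := ne_top_of_le_ne_top (ENNReal.add_ne_top.2 ⟨hβ, hFx⟩) (le_add_self.trans h)
  have hsum : p + Φ = n + β := by
    rw [← lintegral_add_right _ hFm, ← lintegral_add_right _ hbm]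
    exact lintegral_congr fun s => toENNReal_coe_sub_add (hb0 _) _
  have hpβ : p ≤ β := lintegral_mono fun s => by
    rw [← EReal.real_coe_toENNReal]
    exact EReal.toENNReal_le_toENNReal (by
      rw [sub_eq_add_neg]
      exact add_le_of_nonpos_right (by simpa using EReal.coe_ennreal_nonneg _))
  have hp' : p ≠ ⊤ := ne_top_of_le_ne_top hβ hpβ
  have hn' : n ≠ ⊤ := ne_top_of_le_ne_top (ENNReal.add_ne_top.2 ⟨hp', hΦ⟩)
    (le_self_add.trans hsum.ge)
  have e1 := congrArg ENNReal.toReal hsum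
  rw [ENNReal.toReal_add hp' hΦ, ENNReal.toReal_add hn' hβ] at e1
  have e2 := ENNReal.toReal_mono (ENNReal.add_ne_top.2 ⟨hβ, hFx⟩) h
  rw [ENNReal.toReal_add ENNReal.ofReal_ne_top hΦ, ENNReal.toReal_add hβ hFx,
    ENNReal.toReal_ofReal (hb0 x)] at e2
  rw [sphereMean, ← hp, ← hn, ← EReal.coe_ennreal_toReal hFx, ← EReal.coe_ennreal_toReal hp',
    ← EReal.coe_ennreal_toReal hn', ← EReal.coe_sub, ← EReal.coe_sub, EReal.coe_le_coe_iff]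
  linarith

theorem tsum_ofReal_half_pow_mul {a : ℝ} (ha : 0 ≤ a) :
    ∑' n : ℕ, ENNReal.ofReal ((1 / 2 : ℝ) ^ n * a) = ENNReal.ofReal (2 * a) := by
  rw [← ENNReal.ofReal_tsum_of_nonneg (fun n => by positivity)
    (summable_geometric_two.mul_right a), tsum_mul_right, tsum_geometric_two]

/-- A weighted sum `∑ 2⁻ⁿ (Gₙ - cₙ)` of subharmonic functions in the plane whose terms have a common
majorant `P` is subharmonic. The set where its terms are at most `P - 2ⁿ` before weighting is polar
if the sum is finite somewhere. -/
theorem isPolar_of_series {G : ℕ → Space 2 → ℝ} {c : ℕ → ℝ} {P : Space 2 → ℝ} {E : Set (Space 2)}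
    {y : Space 2} {A : ℝ} (hG : ∀ n x, LocSub (G n) x) (hG0 : ∀ n x, 0 ≤ G n x)
    (hP : Continuous P) (hP0 : ∀ x, 0 ≤ P x) (hGP : ∀ n x, G n x ≤ c n + P x)
    (hE : ∀ p ∈ E, ∀ n, (2 : ℝ) ^ n ≤ P p - G n p + c n)
    (hy : ∀ n, P y - G n y + c n ≤ A) : IsPolar E := by
  set f : ℕ → Space 2 → ℝ≥0∞ := fun n x =>
    ENNReal.ofReal ((1 / 2 : ℝ) ^ n * (P x - G n x + c n)) with hf
  set F : Space 2 → ℝ≥0∞ := fun x => ∑' n, f n x with hF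
  have hGusc : ∀ n, UpperSemicontinuous (G n) := fun n x => (hG n x).usc
  have hlsc : ∀ n, LowerSemicontinuous (f n) := by
    intro n
    have h1 : LowerSemicontinuous fun x => P x - G n x + c n := by
      intro x a ha
      have ha' : a < P x - G n x + c n := ha
      set η := (P x - G n x + c n - a) / 2 with hη
      have hη0 : 0 < η := by rw [hη]; linarith
      filter_upwards [hGusc n x (G n x + η) (by linarith : G n x < _),
        hP.continuousAt.eventually (lt_mem_nhds (sub_lt_self (P x) hη0))] with z hz hz'
      have hz1 : G n z < G n x + η := hz
      change a < P z - G n z + c n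
      linarith
    have h2 : Continuous fun t : ℝ => ENNReal.ofReal ((1 / 2 : ℝ) ^ n * t) :=
      ENNReal.continuous_ofReal.comp (continuous_const_mul _)
    exact h2.comp_lowerSemicontinuous h1 fun a b hab => ENNReal.ofReal_le_ofReal (by gcongr)
  have hFlsc : LowerSemicontinuous F := lowerSemicontinuous_tsum hlsc
  have hFy : F y ≠ ⊤ := by
    have hA : 0 ≤ A := by linarith [hy 0, hGP 0 y]
    refine ne_top_of_le_ne_top ENNReal.ofReal_ne_top (b := ENNReal.ofReal (2 * A)) ?_
    rw [← tsum_ofReal_half_pow_mul hA]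
    refine ENNReal.tsum_le_tsum fun n => ENNReal.ofReal_le_ofReal ?_
    exact mul_le_mul_of_nonneg_left (hy n) (by positivity)
  -- `∑ 2⁻ⁿ (G n - c n)`, written as `2 * P` minus a sum of nonnegative terms
  refine ⟨fun x => ((2 * P x : ℝ) : EReal) - (F x : EReal), ⟨isOpen_univ, ?_, ?_, ?_⟩, ⟨y, ?_⟩, ?_⟩
  · intro x _
    rw [sub_eq_add_neg]
    exact EReal.add_ne_top (EReal.coe_ne_top _) (by simp [EReal.neg_eq_top_iff])
  · rw [upperSemicontinuousOn_univ_iff]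
    have h1 : UpperSemicontinuous fun x => ((2 * P x : ℝ) : EReal) :=
      (continuous_coe_real_ereal.comp (hP.const_mul 2)).upperSemicontinuous
    have h2 : UpperSemicontinuous fun x => -(F x : EReal) :=
      (continuous_neg.comp continuous_coe_ennreal_ereal).comp_lowerSemicontinuous_antitone hFlsc
        fun a b hab => EReal.neg_le_neg_iff.2 (EReal.coe_ennreal_le_coe_ennreal_iff.2 hab)
    simp only [sub_eq_add_neg]
    exact h1.add' h2 fun x => EReal.continuousAt_add (Or.inl (EReal.coe_ne_top _))
      (Or.inl (EReal.coe_ne_bot _))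
  · intro x ρ hρ _
    refine coe_sub_le_sphereMean (b := fun z => 2 * P z) (hP.const_mul 2)
      (fun z => by linarith [hP0 z]) hFlsc.measurable ?_
    have hterm : ∀ n, ENNReal.ofReal ((1 / 2 : ℝ) ^ n * P x)
        + ∫⁻ s : sphere (0 : Space 2) 1, f n (x + ρ • (s : Space 2)) ∂(sphereProb 2)
        ≤ ∫⁻ s : sphere (0 : Space 2) 1, ENNReal.ofReal ((1 / 2 : ℝ) ^ n
          * P (x + ρ • (s : Space 2))) ∂(sphereProb 2) + f n x := by
      intro n
      have hGint := integrable_sphere_of_usc hρ ((hGusc n).upperSemicontinuousOn (closedBall x ρ))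
        (m := 0) fun z _ => by simpa using hG0 n z
      have hPint : Integrable (fun s : sphere (0 : Space 2) 1 => P (x + ρ • (s : Space 2)))
        (sphereProb 2) := integrable_of_continuous (by fun_prop)
      have hmean := LocSub.le_integral (hG n) (m := 0) (fun z => by simpa using hG0 n z)
        (x := x) hρ
      have hint2 : Integrable (fun s : sphere (0 : Space 2) 1 => (1 / 2 : ℝ) ^ n
          * (P (x + ρ • (s : Space 2)) - G n (x + ρ • (s : Space 2)) + c n)) (sphereProb 2) :=
        ((hPint.sub hGint).add (integrable_const (c n))).const_mul ((1 / 2 : ℝ) ^ n)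
      simp only [hf]
      rw [← ofReal_integral_eq_lintegral_ofReal hint2 (Eventually.of_forall fun s => mul_nonneg
          (by positivity) (by linarith [hGP n (x + ρ • (s : Space 2))])),
        ← ofReal_integral_eq_lintegral_ofReal (hPint.const_mul _)
          (Eventually.of_forall fun s => mul_nonneg (by positivity) (hP0 _)),
        integral_const_mul, integral_const_mul, integral_add (by exact hPint.sub hGint)
          (integrable_const _),
        integral_sub hPint hGint, integral_const, probReal_univ, one_smul]
      have hI : 0 ≤ ∫ s : sphere (0 : Space 2) 1, P (x + ρ • (s : Space 2)) ∂(sphereProb 2) :=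
        integral_nonneg fun s => hP0 _
      have hJ : ∫ s : sphere (0 : Space 2) 1, G n (x + ρ • (s : Space 2)) ∂(sphereProb 2)
          ≤ c n + ∫ s : sphere (0 : Space 2) 1, P (x + ρ • (s : Space 2)) ∂(sphereProb 2) := by
        have := integral_mono hGint ((integrable_const (c n)).add hPint) fun s => hGP n _
        rw [integral_add' (integrable_const _) hPint] at this
        simpa using this
      have hq : 0 ≤ (1 / 2 : ℝ) ^ n := by positivity
      rw [← ENNReal.ofReal_add (mul_nonneg hq (hP0 x)) (mul_nonneg hq (by linarith)),
        ← ENNReal.ofReal_add (mul_nonneg hq hI) (mul_nonneg hq (by linarith [hGP n x])),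
        ← mul_add, ← mul_add]
      exact ENNReal.ofReal_le_ofReal (mul_le_mul_of_nonneg_left (by linarith) hq)
    have hfm : ∀ n, AEMeasurable (fun s : sphere (0 : Space 2) 1 => f n (x + ρ • (s : Space 2)))
        (sphereProb 2) := fun n =>
      ((hlsc n).measurable.comp (Continuous.measurable (by fun_prop))).aemeasurable
    have hPm : ∀ n : ℕ, AEMeasurable (fun s : sphere (0 : Space 2) 1 =>
        ENNReal.ofReal ((1 / 2 : ℝ) ^ n * P (x + ρ • (s : Space 2)))) (sphereProb 2) := fun n =>
      (Continuous.measurable (by fun_prop)).ennreal_ofReal.aemeasurable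
    have hsum := ENNReal.tsum_le_tsum hterm
    rw [ENNReal.tsum_add, ENNReal.tsum_add, tsum_ofReal_half_pow_mul (hP0 x),
      ← lintegral_tsum hfm, ← lintegral_tsum hPm] at hsum
    simp only [tsum_ofReal_half_pow_mul (hP0 _)] at hsum
    exact hsum
  · beta_reduce
    rw [← EReal.coe_ennreal_toReal hFy, ← EReal.coe_sub]
    exact EReal.coe_ne_bot _
  · intro p hp
    have : F p = ⊤ := by
      rw [← top_le_iff, ← ENNReal.tsum_const_eq_top_of_ne_zero (α := ℕ) (one_ne_zero)]
      refine ENNReal.tsum_le_tsum fun n => ?_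
      rw [← ENNReal.ofReal_one]
      refine ENNReal.ofReal_le_ofReal ?_
      calc (1 : ℝ) = (1 / 2 : ℝ) ^ n * 2 ^ n := by rw [← mul_pow]; norm_num
        _ ≤ _ := mul_le_mul_of_nonneg_left (hE p hp n) (by positivity)
    simp [this]

end

section

variable {d : ℕ}

/-! ### Upper bounds for Arens–Singer potentials -/

theorem not_isBounded_le_norm_sub [NeZero d] (o : Space d) (R : ℝ) :
    ¬ Bornology.IsBounded {x : Space d | R ≤ ‖x - o‖} := by
  intro h
  refine NormedSpace.unbounded_univ ℝ (Space d) ((h.union (isBounded_ball (x := o) (r := R))).subset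
    fun x _ => ?_)
  rcases le_or_gt R ‖x - o‖ with h | h
  · exact Or.inl h
  · exact Or.inr (by rwa [mem_ball, dist_eq_norm])

theorem isSubharmonicOn_of_mem_sbh00 {D : Set (Space d)} {o : Space d} (hD : IsOpen D)
    {V : Space d → EReal} (hV : V ∈ sbh00 D {o}) : IsSubharmonicOn V (D \ {o}) :=
  isSubharmonicOn_of_mem_sbh (hD.sdiff isClosed_singleton) hV.1

/-- Outside a ball about the pole, a truncated potential attains its supremum on the boundary of the
ball, and this supremum is nonnegative. -/
theorem exists_truncExt_max_sphere [NeZero d] {D : Set (Space d)} {o : Space d} (hD : IsOpen D)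
    {V : Space d → EReal} (hV : V ∈ sbh00 D {o}) {m R : ℝ} (hm : 0 ≤ m) (hR : 0 < R) :
    ∃ y, ‖y - o‖ = R ∧ 0 ≤ truncExt m D o V y ∧
      ∀ x, R ≤ ‖x - o‖ → truncExt m D o V x ≤ truncExt m D o V y := by
  obtain ⟨T, ⟨hTc, hTD⟩, hT⟩ := hV.2
  have hloc : ∀ x, x ≠ o → LocSub (truncExt m D o V) x := fun x hx =>
    locSub_truncExt hm (isSubharmonicOn_of_mem_sbh00 hD hV) (hTD.trans interior_subset) hT hx
  have hne : ∀ x : Space d, R ≤ ‖x - o‖ → x ≠ o := by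
    rintro x hx rfl
    simp at hx
    linarith
  obtain ⟨y, hy, hy0, hmax⟩ := LocSub.exists_isMaxOn_diff (U := {x : Space d | R < ‖x - o‖})
    (K := {x : Space d | R ≤ ‖x - o‖}) (C := closure T) (p := o) (v := truncExt m D o V)
    (isOpen_lt continuous_const (by fun_prop)) (fun x (hx : R < ‖x - o‖) => hx.le)
    (isClosed_le continuous_const (by fun_prop)) (not_isBounded_le_norm_sub o R)
    (fun h => hne o h rfl) (fun x (hx : R < ‖x - o‖) => hloc x (hne x hx.le))
    (fun x hx => (hloc x (hne x hx)).usc.upperSemicontinuousWithinAt _) hTc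
    (fun x _ hx => truncExt_eq_zero hm hT fun h => hx (subset_closure h))
  exact ⟨y, le_antisymm (not_lt.1 hy.2) hy.1, hy0, hmax⟩

theorem kernelK_of_ne {o y : Space d} (h : y ≠ o) :
    kernelK o y = ((kFun ((d : ℝ) - 2) ‖y - o‖ : ℝ) : EReal) := by
  rw [kernelK, if_pos h.symm, norm_sub_rev]

/-- The growth condition at the pole in terms of truncated potentials. -/
theorem exists_truncExt_le_near_pole {D : Set (Space d)} {o : Space d} (hD : IsOpen D)
    {V : Space d → EReal} (hV : V ∈ ASP D o) :
    ∃ C : ℝ, ∀ᶠ y in 𝓝[≠] o, truncExt 0 D o V y ≤ max (-kFun ((d : ℝ) - 2) ‖y - o‖ + C) 0 := by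
  obtain ⟨hV0, C, hC⟩ := hV
  refine ⟨C, ?_⟩
  filter_upwards [hC, self_mem_nhdsWithin] with y hy hyo
  by_cases hyD : y ∈ D \ {o}
  · rw [truncExt, indicator_of_mem hyD,
      trunc_le_iff ((isSubharmonicOn_of_mem_sbh00 hD hV0).ne_top y hyD)]
    refine ⟨?_, by simp⟩
    rw [kernelK_of_ne hyo, ← EReal.coe_neg, ← EReal.coe_add] at hy
    exact hy.trans (EReal.coe_le_coe_iff.2 (le_max_left _ _))
  · rw [truncExt, indicator_of_notMem hyD]
    exact le_max_right _ _

theorem tendsto_norm_sub_nhdsGT (o : Space d) :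
    Tendsto (fun y : Space d => ‖y - o‖) (𝓝[≠] o) (𝓝[>] 0) := by
  refine tendsto_nhdsWithin_iff.2 ⟨?_, ?_⟩
  · have : Tendsto (fun y : Space d => ‖y - o‖) (𝓝 o) (𝓝 ‖o - o‖) :=
      Continuous.tendsto (by fun_prop) o
    rw [sub_self, norm_zero] at this
    exact this.mono_left nhdsWithin_le_nhds
  · filter_upwards [self_mem_nhdsWithin] with y hy
    exact norm_pos_iff.2 (sub_ne_zero.2 hy)

/-- In dimension `d ≥ 3` the potentials are at most twice the fundamental solution. The factor `2`
absorbs the bounded term in the condition at the pole. -/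
theorem truncExt_le_rpow (hd : 3 ≤ d) {D : Set (Space d)} {o : Space d} (hD : IsOpen D)
    {V : Space d → EReal} (hV : V ∈ ASP D o) {x : Space d} (hx : x ≠ o) :
    truncExt 0 D o V x ≤ 2 * (‖x - o‖ ^ 2) ^ (-(((d : ℝ) - 2) / 2)) := by
  have : NeZero d := ⟨by omega⟩
  obtain ⟨C, hC⟩ := exists_truncExt_le_near_pole hD hV
  obtain ⟨T, ⟨hTc, hTD⟩, hT⟩ := hV.1.2
  have hd3 : (3 : ℝ) ≤ d := by exact_mod_cast hd
  set α : ℝ := ((d : ℝ) - 2) / 2 with hα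
  have hα0 : 0 < α := by rw [hα]; linarith
  have hk : ∀ t : ℝ, 0 < t → -kFun ((d : ℝ) - 2) t = (t ^ 2) ^ (-α) := by
    intro t ht
    rw [kFun, if_neg (by linarith), Real.sign_of_pos (by linarith), neg_one_mul, neg_neg,
      ← Real.rpow_natCast, ← Real.rpow_mul ht.le]
    congr 1
    rw [hα]; push_cast; ring
  have hpole : ∀ᶠ y in 𝓝[≠] o, truncExt 0 D o V y ≤ 2 * (‖y - o‖ ^ 2) ^ (-α) := by
    have h1 : Tendsto (fun t : ℝ => t ^ (-(2 * α))) (𝓝[>] 0) atTop :=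
      tendsto_rpow_neg_nhdsGT_zero (by linarith)
    filter_upwards [hC, (tendsto_norm_sub_nhdsGT o).eventually (h1.eventually_ge_atTop C),
      self_mem_nhdsWithin] with y hy hy1 hyo
    have ht : 0 < ‖y - o‖ := norm_pos_iff.2 (sub_ne_zero.2 hyo)
    have h2 : (‖y - o‖ ^ 2) ^ (-α) = ‖y - o‖ ^ (-(2 * α)) := by
      rw [← Real.rpow_natCast, ← Real.rpow_mul ht.le]; congr 1; push_cast; ring
    have h3 : 0 ≤ (‖y - o‖ ^ 2) ^ (-α) := by positivity
    rw [hk _ ht] at hy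
    refine hy.trans (max_le ?_ (by linarith))
    rw [← h2] at hy1
    linarith
  obtain ⟨η, hη, hball⟩ := Metric.eventually_nhds_iff_ball.1 (eventually_nhdsWithin_iff.1 hpole)
  obtain ⟨R, hR⟩ := (hTc.insert x).isBounded.subset_ball o
  -- `δ ‖· - o‖²` makes the comparison function strictly subharmonic, as `locSub_radial` requires
  have hbound : ∀ δ > 0, truncExt 0 D o V x ≤ 2 * (‖x - o‖ ^ 2) ^ (-α) + δ * R ^ 2 := by
    intro δ hδ
    have hcomp : IsCompact (closure T \ ball o η) := hTc.diff isOpen_ball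
    have := LocSub.nonpos_of_isCompact (isOpen_ball.sdiff isClosed_singleton) hcomp
      (U := ball o R \ {o}) (fun y hy => ⟨hR (mem_insert_of_mem _ hy.1), fun h => hy.2 ?_⟩)
      (fun y hy => (locSub_truncExt le_rfl (isSubharmonicOn_of_mem_sbh00 hD hV.1)
        (hTD.trans interior_subset) hT hy.2).add (locSub_rpow hd hy.2 hδ (δ * R ^ 2)))
      (fun y hy hpos => ?_) x ⟨hR (mem_insert _ _), hx⟩
    · have h4 : 0 ≤ δ * ‖x - o‖ ^ 2 := by positivity
      rw [← hα] at this
      linarith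
    · rw [mem_singleton_iff.1 h]; exact mem_ball_self hη
    · rw [← hα] at hpos
      have hyR : ‖y - o‖ ^ 2 ≤ R ^ 2 := by
        have h5 := hy.1
        rw [mem_ball, dist_eq_norm] at h5
        exact pow_le_pow_left₀ (norm_nonneg _) h5.le 2
      have h6 : δ * ‖y - o‖ ^ 2 ≤ δ * R ^ 2 := mul_le_mul_of_nonneg_left hyR hδ.le
      have h7 : 0 ≤ (‖y - o‖ ^ 2) ^ (-α) := by positivity
      constructor
      · by_contra hyT
        rw [truncExt_eq_zero le_rfl hT fun h => hyT (subset_closure h)] at hpos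
        linarith
      · intro hyη
        linarith [hball y hyη hy.2]
  refine le_of_forall_pos_le_add fun ε hε => ?_
  refine (hbound (ε / (R ^ 2 + 1)) (by positivity)).trans ?_
  have : ε / (R ^ 2 + 1) * R ^ 2 ≤ ε := by
    rw [div_mul_eq_mul_div, div_le_iff₀ (by positivity)]
    nlinarith [sq_nonneg R]
  linarith

end

section

/-! ### The upper bound in the plane -/

/-- A radial strictly subharmonic function on the punctured plane with a logarithmic pole of
strength `2` at `o`, nonnegative off the disc of radius `R`. As `Real.log 0 = 0`, its value at `o`
is `0`. -/
def logBarrier (o : Space 2) (R : ℝ) (y : Space 2) : ℝ :=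
  Real.log (‖y - o‖ ^ 2 / R ^ 2) + ‖y - o‖ ^ 2

theorem locSub_logBarrier {o x : Space 2} {R : ℝ} (hR : 0 < R) (hx : x ≠ o) :
    LocSub (logBarrier o R) x := by
  refine (locSub_log hx (Real.log (R ^ 2))).congr ?_
  filter_upwards [isOpen_compl_singleton.mem_nhds hx] with y hy
  rw [logBarrier, Real.log_div (norm_sub_sq_pos hy).ne' (by positivity)]
  ring

theorem logBarrier_le {o y : Space 2} {R : ℝ} (hR : 0 < R) :
    logBarrier o R y ≤ 2 * (‖y - o‖ / R) + ‖y - o‖ ^ 2 := by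
  rw [logBarrier, ← div_pow, Real.log_pow]
  have := Real.log_le_self (x := ‖y - o‖ / R) (by positivity)
  push_cast
  linarith

theorem logBarrier_le_of_le {o y : Space 2} {R : ℝ} (hR : 0 < R) (hy0 : R ≤ ‖y - o‖)
    (hy : ‖y - o‖ ≤ 2 * R) : logBarrier o R y ≤ Real.log 4 + 4 * R ^ 2 := by
  have h1 : ‖y - o‖ ^ 2 ≤ 4 * R ^ 2 := by nlinarith [norm_nonneg (y - o)]
  have h2 : 0 < ‖y - o‖ ^ 2 := by nlinarith
  have := Real.log_le_log (x := ‖y - o‖ ^ 2 / R ^ 2) (y := 4) (by positivity)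
    (by rw [div_le_iff₀ (by positivity)]; exact h1)
  rw [logBarrier]
  linarith

/-- A truncated potential in the plane, made subharmonic on the whole plane: the pole is
overcompensated by the barrier, so that the maximum with `0` vanishes near `o`. -/
def poleFree (D : Set (Space 2)) (o : Space 2) (R : ℝ) (V : Space 2 → EReal) (y : Space 2) : ℝ :=
  max (truncExt 0 D o V y + logBarrier o R y) 0

theorem locSub_poleFree {D : Set (Space 2)} {o : Space 2} (hD : IsOpen D) {R : ℝ} (hR : 0 < R)
    {V : Space 2 → EReal} (hV : V ∈ ASP D o) (x : Space 2) : LocSub (poleFree D o R V) x := by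
  obtain ⟨T, ⟨hTc, hTD⟩, hT⟩ := hV.1.2
  by_cases hx : x = o
  · subst hx
    refine (LocSub.const 0 x).congr ?_
    obtain ⟨C, hC⟩ := exists_truncExt_le_near_pole hD hV
    set A := |C| + 1 + |Real.log (R ^ 2)| with hA
    have hlog : ∀ᶠ y in 𝓝[≠] x, Real.log ‖y - x‖ ≤ -A :=
      (tendsto_norm_sub_nhdsGT x).eventually (Real.tendsto_log_nhdsGT_zero.eventually_le_atBot _)
    have hone : ∀ᶠ y in 𝓝[≠] x, ‖y - x‖ < 1 :=
      (tendsto_norm_sub_nhdsGT x).eventually (mem_nhdsWithin_of_mem_nhds (Iio_mem_nhds one_pos))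
    filter_upwards [eventually_nhdsWithin_iff.1 (hC.and (hlog.and hone))] with y hy
    by_cases hyx : y = x
    · subst hyx
      simp [poleFree, logBarrier, truncExt]
    · obtain ⟨h1, h2, h3⟩ := hy hyx
      have hq := norm_sub_sq_pos hyx
      have h4 : ‖y - x‖ ^ 2 ≤ 1 := pow_le_one₀ (norm_nonneg _) h3.le
      have h5 : logBarrier x R y = 2 * Real.log ‖y - x‖ - Real.log (R ^ 2) + ‖y - x‖ ^ 2 := by
        rw [logBarrier, Real.log_div hq.ne' (by positivity), Real.log_pow]
        push_cast
        ring
      have h6 : kFun (((2 : ℕ) : ℝ) - 2) ‖y - x‖ = Real.log ‖y - x‖ := by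
        rw [kFun, if_pos (by norm_num)]
      rw [h6] at h1
      refine (max_eq_right ?_).symm
      rw [h5]
      have h7 := neg_abs_le (Real.log (R ^ 2))
      have h8 := le_abs_self C
      have h9 := abs_nonneg C
      have h10 := abs_nonneg (Real.log (R ^ 2))
      rcases max_cases (-Real.log ‖y - x‖ + C) 0 with ⟨h, -⟩ | ⟨h, -⟩ <;> rw [h] at h1 <;> linarith
  · exact ((locSub_truncExt le_rfl (isSubharmonicOn_of_mem_sbh00 hD hV.1)
      (hTD.trans interior_subset) hT hx).add (locSub_logBarrier hR hx)).sup (LocSub.const 0 x)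

/-- The continuous majorant in `poleFree_le`. -/
def planarMajorant (o : Space 2) (R : ℝ) (y : Space 2) : ℝ :=
  2 * (‖y - o‖ / R) + ‖y - o‖ ^ 2 + (Real.log 4 + 4 * R ^ 2)

theorem poleFree_le {D : Set (Space 2)} {o : Space 2} (hD : IsOpen D) {R : ℝ} (hR : 0 < R)
    {V : Space 2 → EReal} (hV : V ∈ ASP D o) {c : ℝ} (hc0 : 0 ≤ c)
    (hc : ∀ x, R ≤ ‖x - o‖ → truncExt 0 D o V x ≤ c) (x : Space 2) :
    poleFree D o R V x ≤ c + planarMajorant o R x := by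
  have hlog4 : 0 < Real.log 4 := Real.log_pos (by norm_num)
  have hΛ : 0 < Real.log 4 + 4 * R ^ 2 := by positivity
  have h0 : 0 ≤ 2 * (‖x - o‖ / R) + ‖x - o‖ ^ 2 := by positivity
  rcases le_or_gt R ‖x - o‖ with hx | hx
  · refine max_le ?_ (by rw [planarMajorant]; linarith)
    rw [planarMajorant]
    linarith [hc x hx, logBarrier_le (o := o) (y := x) hR]
  · have := LocSub.nonpos_of_isCompact (U := ball o (2 * R)) (C := closedBall o R)
      (φ := fun y => poleFree D o R V y + -(c + (Real.log 4 + 4 * R ^ 2))) isOpen_ball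
      (isCompact_closedBall o R) (closedBall_subset_ball (by linarith))
      (fun y _ => (locSub_poleFree hD hR hV y).add (LocSub.const _ y)) (fun y hy hpos => ?_) x
      (by rw [mem_ball, dist_eq_norm]; linarith)
    · rw [planarMajorant]
      linarith
    · by_contra hyR
      rw [mem_closedBall, dist_eq_norm, not_le] at hyR
      rw [mem_ball, dist_eq_norm] at hy
      have : poleFree D o R V y ≤ c + (Real.log 4 + 4 * R ^ 2) :=
        max_le (by linarith [hc y hyR.le, logBarrier_le_of_le hR hyR.le hy.le]) (by linarith)
      linarith

/-- **Uniform upper bound in the plane.** If the maxima `cₙ` of potentials `Vₙ` over a circle about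
the pole were unbounded, then along a sequence with `cₙ ≥ 2ⁿ` the series `∑ 2⁻ⁿ (Vₙ - cₙ)`, made
subharmonic at the pole, would be `-∞` on the boundary of `D`, where the `Vₙ` vanish, and finite on
the circle, where `cₙ - Vₙ` is bounded by Harnack's inequality. So the boundary would be polar. -/
theorem exists_planar_bound {D D₀ : Set (Space 2)} {o : Space 2} (hD : IsOpen D)
    (hDnp : ¬ IsPolar (frontier D)) (hD₀ : IsOpen D₀) (hD₀D : D₀ ⊆ D)
    (hD₀c : IsPreconnected (D₀ \ {o})) {R : ℝ} (hR : 0 < R) (hRD₀ : closedBall o R ⊆ D₀) :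
    ∃ B : ℝ, ∀ V ∈ ASP D o ∩ har (D₀ \ {o}), ∀ x, R ≤ ‖x - o‖ → truncExt 0 D o V x ≤ B := by
  by_contra! hcon
  choose V hV z hz hzV using fun n : ℕ => hcon (2 ^ n)
  choose y hy hy0 hymax using fun n => exists_truncExt_max_sphere hD (hV n).1.1 le_rfl hR
  set c : ℕ → ℝ := fun n => truncExt 0 D o (V n) (y n) with hc
  have hc2 : ∀ n, (2 : ℝ) ^ n ≤ c n := fun n => (hzV n).le.trans (hymax n _ (hz n))
  have hΩ : IsOpen (D₀ \ {o}) := hD₀.sdiff isClosed_singleton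
  have hne : ∀ x : Space 2, ‖x - o‖ = R → x ≠ o := by
    rintro x hx rfl
    rw [sub_self, norm_zero] at hx
    exact hR.ne hx
  have hsph : ∀ x : Space 2, ‖x - o‖ = R → x ∈ D₀ \ {o} := fun x hx =>
    ⟨hRD₀ (by rw [mem_closedBall, dist_eq_norm, hx]), hne x hx⟩
  have hKΩ : sphere o R ⊆ D₀ \ {o} := fun x hx => hsph x (by rwa [← dist_eq_norm])
  obtain ⟨L, hLΩ, hL, C, -, hH⟩ := exists_harnack hΩ hD₀c (isCompact_sphere o R) hKΩ
  have hPc : Continuous (planarMajorant o R) := by unfold planarMajorant; fun_prop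
  have hLc : ContinuousOn (fun x => planarMajorant o R x - logBarrier o R x) L := by
    refine hPc.continuousOn.sub fun x hx => ContinuousAt.continuousWithinAt ?_
    have hq := norm_sub_sq_pos (hLΩ hx).2
    unfold logBarrier
    exact (ContinuousAt.log (by fun_prop) (by positivity)).add (by fun_prop)
  obtain ⟨A, hA⟩ := hL.exists_bound_of_continuousOn hLc
  have hmaj := fun n => poleFree_le hD hR (hV n).1 (hy0 n) (hymax n)
  have hΩtrunc : ∀ n, ∀ x ∈ D₀ \ {o}, truncExt 0 D o (V n) x = max (V n x).toReal 0 := by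
    intro n x hx
    have hxD : x ∈ D \ {o} := ⟨hD₀D hx.1, hx.2⟩
    rw [truncExt, indicator_of_mem hxD,
      trunc_coe (coe_toReal_of_har hΩ (hV n).2 hx).symm, neg_zero]
  refine hDnp (isPolar_of_series (G := fun n => poleFree D o R (V n)) (c := c)
    (P := planarMajorant o R) (y := y 0)
    (A := planarMajorant o R (y 0) - logBarrier o R (y 0) - A + C * A)
    (fun n => locSub_poleFree hD hR (hV n).1) (fun n x => le_max_right _ _) hPc (fun x => ?_)
    hmaj (fun p hp n => ?_) (fun n => ?_))
  · have : 0 < Real.log 4 := Real.log_pos (by norm_num)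
    rw [planarMajorant]
    positivity
  · have hpD : p ∉ D := fun h => by
      rw [hD.frontier_eq] at hp
      exact hp.2 h
    have h1 : truncExt 0 D o (V n) p = 0 := by
      rw [truncExt, indicator_of_notMem fun h => hpD h.1]
    have h2 : poleFree D o R (V n) p ≤ planarMajorant o R p := by
      have h3 : 0 < Real.log 4 := Real.log_pos (by norm_num)
      rw [poleFree, h1, zero_add]
      refine max_le ?_ (by rw [planarMajorant]; positivity)
      rw [planarMajorant]
      have : 0 < Real.log 4 + 4 * R ^ 2 := by positivity
      linarith [logBarrier_le (o := o) (y := p) hR]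
    linarith [hc2 n]
  -- Harnack's inequality for `c n + A - V n`, equal to `A` at `y n`, bounds `c n - V n` at `y 0`
  · have hharm := (isHarmonicReal_of_har hΩ (hV n).2).const_sub (c n + A)
    have hle := hH _ hharm (fun x hx => ?_) (y 0) (by rw [mem_sphere, dist_eq_norm, hy])
      (y n) (by rw [mem_sphere, dist_eq_norm, hy])
    · have hyn : (V n (y n)).toReal = c n := by
        have h1 := hΩtrunc n (y n) (hsph _ (hy n))
        rcases max_cases (V n (y n)).toReal 0 with ⟨h, -⟩ | ⟨h, -⟩
        · exact (h1.trans h).symm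
        · have h2 := hc2 n
          have h3 : (0 : ℝ) < 2 ^ n := by positivity
          rw [h] at h1
          linarith
      have h4 : (V n (y 0)).toReal ≤ truncExt 0 D o (V n) (y 0) := by
        rw [hΩtrunc n _ (hsph _ (hy 0))]
        exact le_max_left _ _
      have h5 : truncExt 0 D o (V n) (y 0) + logBarrier o R (y 0) ≤ poleFree D o R (V n) (y 0) :=
        le_max_left _ _
      rw [hyn] at hle
      simp only [add_sub_cancel_left] at hle
      linarith
    · have h1 : (V n x).toReal ≤ truncExt 0 D o (V n) x := by
        rw [hΩtrunc n _ (hLΩ hx)]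
        exact le_max_left _ _
      have h2 : truncExt 0 D o (V n) x + logBarrier o R x ≤ poleFree D o R (V n) x :=
        le_max_left _ _
      have h3 := (abs_le.1 (hA x hx)).2
      linarith [hmaj n x]

end

section

variable {d : ℕ}

/-! ### Uniform bounds in dimension at least two -/

theorem one_lt_rank_space (hd : 2 ≤ d) : 1 < Module.rank ℝ (Space d) :=
  Module.one_lt_rank_of_one_lt_finrank (by rw [finrank_euclideanSpace_fin]; omega)

theorem isPreconnected_ball_diff_singleton (hd : 2 ≤ d) (o : Space d) (ε : ℝ) :
    IsPreconnected (ball o ε \ {o}) := by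
  have h1 : IsPreconnected (sphere (0 : Space d) 1 ×ˢ Ioo (0 : ℝ) ε) :=
    (isConnected_sphere (one_lt_rank_space hd) 0 zero_le_one).isPreconnected.prod isPreconnected_Ioo
  have h2 := h1.image (fun p : Space d × ℝ => o + p.2 • p.1) (by fun_prop)
  convert h2 using 1
  ext x
  simp only [Set.mem_sdiff, mem_ball, dist_eq_norm, mem_singleton_iff, mem_image, mem_prod,
    mem_sphere, sub_zero, mem_Ioo, Prod.exists]
  constructor
  · rintro ⟨hx, hxo⟩
    have hpos : 0 < ‖x - o‖ := norm_pos_iff.2 (sub_ne_zero.2 hxo)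
    refine ⟨‖x - o‖⁻¹ • (x - o), ‖x - o‖, ⟨?_, hpos, hx⟩, ?_⟩
    · rw [norm_smul, norm_inv, norm_norm, inv_mul_cancel₀ hpos.ne']
    · rw [smul_smul, mul_inv_cancel₀ hpos.ne', one_smul, add_sub_cancel]
  · rintro ⟨s, t, ⟨hs, ht0, ht⟩, rfl⟩
    refine ⟨?_, fun h => ?_⟩
    · rw [add_sub_cancel_left, norm_smul, hs, mul_one, Real.norm_eq_abs, abs_of_pos ht0]
      exact ht
    · rw [add_eq_left, smul_eq_zero] at h
      rcases h with h | h
      · exact ht0.ne' h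
      · rw [h, norm_zero] at hs
        exact zero_ne_one hs

/-- Removing a point does not disconnect a connected open set in dimension at least two. -/
theorem isPreconnected_diff_singleton (hd : 2 ≤ d) {Ω : Set (Space d)} (hΩ : IsOpen Ω)
    (hΩc : IsPreconnected Ω) {o : Space d} (ho : o ∈ Ω) : IsPreconnected (Ω \ {o}) := by
  obtain ⟨ε, hε, hsub⟩ := Metric.isOpen_iff.1 hΩ o ho
  have : NeZero d := ⟨by omega⟩
  obtain ⟨z, hz⟩ : ∃ z, z ∈ ball o ε \ {o} := by
    obtain ⟨v, hv⟩ := exists_norm_eq (Space d) (half_pos hε).le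
    refine ⟨o + v, ?_, fun h => ?_⟩
    · rw [mem_ball, dist_eq_norm, add_sub_cancel_left, hv]; linarith
    · rw [mem_singleton_iff, add_eq_left] at h
      rw [h, norm_zero] at hv
      linarith
  refine isPreconnected_of_forall_constant fun f hf x hx y hy => ?_
  have hball : ∀ w ∈ ball o ε \ {o}, f w = f z := fun w hw =>
    (isPreconnected_ball_diff_singleton hd o ε).constant
      (hf.mono (sdiff_subset_sdiff_left hsub)) hw hz
  classical
  -- a locally constant function on `Ω ∖ o` is continued to `o` by its value near `o`
  set g : Space d → Bool := Function.update f o (f z) with hg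
  have hgne : ∀ w, w ≠ o → g w = f w := fun w hw => Function.update_of_ne hw _ _
  have hgc : ContinuousOn g Ω := by
    intro w hw
    by_cases hwo : w = o
    · subst hwo
      refine ContinuousAt.continuousWithinAt
        (ContinuousAt.congr (f := fun _ => f z) continuousAt_const ?_)
      filter_upwards [ball_mem_nhds w hε] with v hv
      by_cases hvo : v = w
      · rw [hvo, hg, Function.update_self]
      · rw [hgne v hvo, hball v ⟨hv, hvo⟩]
    · have hm := (hΩ.sdiff isClosed_singleton).mem_nhds (⟨hw, hwo⟩ : w ∈ Ω \ {o})
      refine ContinuousAt.continuousWithinAt ((hf.continuousAt hm).congr ?_)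
      filter_upwards [hm] with v hv
      exact (hgne v hv.2).symm
  rw [← hgne x hx.2, ← hgne y hy.2]
  exact hΩc.constant hgc hx.1 hy.1

/-- Arens–Singer potentials are bounded above away from the pole, uniformly. -/
theorem exists_upper_bound (hd : 2 ≤ d) {D D₀ : Set (Space d)} {o : Space d} (hD : IsOpen D)
    (hDnp : ¬ IsPolar (frontier D)) (hD₀ : IsOpen D₀) (hD₀c : IsPreconnected D₀) (hD₀D : D₀ ⊆ D)
    (ho : o ∈ D₀) {δ : ℝ} (hδ : 0 < δ) :
    ∃ B : ℝ, 0 ≤ B ∧ ∀ V ∈ ASP D o ∩ har (D₀ \ {o}), ∀ x ∈ D, δ ≤ ‖x - o‖ → V x ≤ B := by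
  suffices h : ∃ B : ℝ, ∀ V ∈ ASP D o ∩ har (D₀ \ {o}), ∀ x, δ ≤ ‖x - o‖ →
      truncExt 0 D o V x ≤ B by
    obtain ⟨B, hB⟩ := h
    refine ⟨max B 0, le_max_right _ _, fun V hV x hxD hx => ?_⟩
    have hxo : x ≠ o := by
      rintro rfl
      rw [sub_self, norm_zero] at hx
      exact hδ.not_ge hx
    have h1 := hB V hV x hx
    have hmem : x ∈ D \ {o} := ⟨hxD, hxo⟩
    rw [truncExt, indicator_of_mem hmem] at h1
    exact (le_coe_trunc 0 ((isSubharmonicOn_of_mem_sbh00 hD hV.1.1).ne_top x hmem)).trans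
      (EReal.coe_le_coe_iff.2 (h1.trans (le_max_left _ _)))
  rcases hd.eq_or_lt with rfl | hd3
  · obtain ⟨ε, hε, hsub⟩ := Metric.isOpen_iff.1 hD₀ o ho
    obtain ⟨B, hB⟩ := exists_planar_bound hD hDnp hD₀ hD₀D
      (isPreconnected_diff_singleton le_rfl hD₀ hD₀c ho) (lt_min hδ (half_pos hε))
      ((closedBall_subset_ball ((min_le_right _ _).trans_lt (half_lt_self hε))).trans hsub)
    exact ⟨B, fun V hV x hx => hB V hV x ((min_le_left _ _).trans hx)⟩
  · refine ⟨2 * (δ ^ 2) ^ (-(((d : ℝ) - 2) / 2)), fun V hV x hx => ?_⟩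
    have hxo : x ≠ o := by
      rintro rfl
      rw [sub_self, norm_zero] at hx
      exact hδ.not_ge hx
    refine (truncExt_le_rpow hd3 hD hV.1 hxo).trans ?_
    have hd3' : (3 : ℝ) ≤ d := by exact_mod_cast hd3
    have := Real.rpow_le_rpow_of_nonpos (z := -(((d : ℝ) - 2) / 2)) (by positivity : 0 < δ ^ 2)
      (pow_le_pow_left₀ hδ.le hx 2) (by linarith)
    linarith

/-- The lower bound: a potential is nonnegative at some point of a small sphere about the pole, and
Harnack's inequality for `B - V`, where `B` is the upper bound, carries this to compact sets. -/
theorem exists_lower_bound (hd : 2 ≤ d) {D D₀ K : Set (Space d)} {o : Space d} (hD : IsOpen D)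
    (hDnp : ¬ IsPolar (frontier D)) (hD₀ : IsOpen D₀) (hD₀c : IsPreconnected D₀) (hD₀D : D₀ ⊆ D)
    (ho : o ∈ D₀) (hK : IsCompact K) (hKD₀ : K ⊆ D₀ \ {o}) :
    ∃ B : ℝ, ∀ V ∈ ASP D o ∩ har (D₀ \ {o}), ∀ x ∈ K, ((-B : ℝ) : EReal) ≤ V x := by
  have : NeZero d := ⟨by omega⟩
  obtain ⟨ε, hε, hsub⟩ := Metric.isOpen_iff.1 hD₀ o ho
  have hR : 0 < ε / 2 := half_pos hε
  have hΩ : IsOpen (D₀ \ {o}) := hD₀.sdiff isClosed_singleton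
  have hsph : sphere o (ε / 2) ⊆ D₀ \ {o} := fun x hx => by
    refine ⟨hsub (sphere_subset_ball (half_lt_self hε) hx), ?_⟩
    rintro rfl
    rw [mem_sphere, dist_self] at hx
    exact hR.ne hx
  obtain ⟨L, hLΩ, hL, C, hC, hH⟩ := exists_harnack hΩ
    (isPreconnected_diff_singleton hd hD₀ hD₀c ho) (hK.union (isCompact_sphere o (ε / 2)))
    (union_subset hKD₀ hsph)
  obtain ⟨δ, hδ, hδL⟩ : ∃ δ > 0, ∀ x ∈ L, δ ≤ ‖x - o‖ := by
    obtain ⟨δ, hδ, hb⟩ := Metric.isOpen_iff.1 hL.isClosed.isOpen_compl o fun h => (hLΩ h).2 rfl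
    refine ⟨δ, hδ, fun x hx => ?_⟩
    by_contra! h
    exact hb (by rwa [mem_ball, dist_eq_norm]) hx
  obtain ⟨B, hB0, hB⟩ := exists_upper_bound hd hD hDnp hD₀ hD₀c hD₀D ho hδ
  -- `B - V x ≤ C * (B - V y) ≤ C * B` for the point `y` of the sphere with `0 ≤ V y`
  refine ⟨C * B, fun V hV x hx => ?_⟩
  have hcoe : ∀ z ∈ D₀ \ {o}, ((V z).toReal : EReal) = V z := fun z hz =>
    coe_toReal_of_har hΩ hV.2 hz
  -- truncation at the negative level `-1`, so that `0 ≤ truncExt` means `0 ≤ V`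
  obtain ⟨y, hy, hy0, -⟩ := exists_truncExt_max_sphere hD hV.1.1 zero_le_one hR
  have hyS : y ∈ sphere o (ε / 2) := by rw [mem_sphere, dist_eq_norm, hy]
  have hyD : y ∈ D \ {o} := ⟨hD₀D (hsph hyS).1, (hsph hyS).2⟩
  rw [truncExt, indicator_of_mem hyD, le_trunc_iff
    ((isSubharmonicOn_of_mem_sbh00 hD hV.1.1).ne_top y hyD) (by norm_num), ← hcoe y (hsph hyS),
    EReal.coe_le_coe_iff] at hy0
  have hle := hH _ ((isHarmonicReal_of_har hΩ hV.2).const_sub B) (fun z hz => ?_) x (Or.inl hx) y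
    (Or.inr hyS)
  · rw [← hcoe x (hKD₀ hx), EReal.coe_le_coe_iff]
    have : C * (B - (V y).toReal) ≤ C * B := mul_le_mul_of_nonneg_left (by linarith) hC
    linarith
  · have h1 := hB V hV z (hD₀D (hLΩ hz).1) (hδL z hz)
    rw [← hcoe z (hLΩ hz), EReal.coe_le_coe_iff] at h1
    linarith

/-! ### Uniform bounds in dimension one -/

theorem inner_sq_space_one (a b : Space 1) : (inner ℝ a b) ^ 2 = ‖a‖ ^ 2 * ‖b‖ ^ 2 := by
  rw [EuclideanSpace.norm_sq_eq, EuclideanSpace.norm_sq_eq, PiLp.inner_apply]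
  simp
  ring

/-- On the line, `-‖· - p‖` is affine off `p`. -/
theorem locSub_neg_norm_sub {p y : Space 1} (hy : y ≠ p) :
    LocSub (fun z : Space 1 => -‖z - p‖) y := by
  have hpos : 0 < ‖y - p‖ := norm_pos_iff.2 (sub_ne_zero.2 hy)
  refine ⟨Continuous.upperSemicontinuous (by fun_prop) y, ?_⟩
  filter_upwards [Ioo_mem_nhdsGT hpos] with ρ hρ
  have hint : Integrable (fun s : sphere (0 : Space 1) 1 => -‖y + ρ • (s : Space 1) - p‖)
    (sphereProb 1) := integrable_of_continuous (by fun_prop)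
  refine ⟨hint, ?_⟩
  have hint2 : Integrable (fun s : sphere (0 : Space 1) 1 =>
      -‖y - p‖ + -(ρ / ‖y - p‖) * inner ℝ (y - p) (s : Space 1)) (sphereProb 1) :=
    integrable_of_continuous (by fun_prop)
  have hle := integral_mono hint2 hint fun s => ?_
  · rw [integral_add (integrable_const _) (integrable_of_continuous (by fun_prop)),
      integral_const_mul, integral_inner_sphere] at hle
    simpa using hle
  · set t : ℝ := inner ℝ (y - p) (s : Space 1) with ht
    have hs : ‖(s : Space 1)‖ = 1 := by simp
    have ht2 : t ^ 2 = ‖y - p‖ ^ 2 := by rw [ht, inner_sq_space_one, hs]; ring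
    have htabs : |t| = ‖y - p‖ := by
      rw [← abs_of_pos hpos]; exact (sq_eq_sq_iff_abs_eq_abs _ _).1 ht2
    have hnn : 0 ≤ ‖y - p‖ + ρ / ‖y - p‖ * t := by
      have h1 : -‖y - p‖ ≤ t := htabs ▸ neg_abs_le t
      have h2 : ρ / ‖y - p‖ * -‖y - p‖ ≤ ρ / ‖y - p‖ * t :=
        mul_le_mul_of_nonneg_left h1 (div_nonneg hρ.1.le hpos.le)
      rw [mul_neg, div_mul_cancel₀ _ hpos.ne'] at h2
      linarith [hρ.2]
    have hsq : ‖y + ρ • (s : Space 1) - p‖ ^ 2 = (‖y - p‖ + ρ / ‖y - p‖ * t) ^ 2 := by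
      have h1 : y + ρ • (s : Space 1) - p = (y - p) + ρ • (s : Space 1) := by abel
      have h2 : (‖y - p‖ + ρ / ‖y - p‖ * t) ^ 2
          = ‖y - p‖ ^ 2 + 2 * ρ * t + ρ ^ 2 * t ^ 2 / ‖y - p‖ ^ 2 := by
        field_simp
        ring
      rw [h2, ht2, mul_div_assoc, div_self (by positivity), h1, norm_add_sq_real,
        inner_smul_right, norm_smul, hs, ← ht, Real.norm_eq_abs, mul_one, sq_abs]
      ring
    have := (sq_le_sq₀ (norm_nonneg _) hnn).1 hsq.le
    simp only
    linarith

/-- On the line, a function that is convex off the pole and vanishes outside a compact subset of `D`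
is nonnegative: the maximum principle applies on the half-line that starts at `y` and leads away
from `o`. -/
theorem nonneg_of_mem_sbh00 {D : Set (Space 1)} {o : Space 1} (hD : IsOpen D)
    {V : Space 1 → EReal} (hV : V ∈ sbh00 D {o}) {y : Space 1} (hy : y ∈ D \ {o}) : 0 ≤ V y := by
  obtain ⟨T, ⟨hTc, hTD⟩, hT⟩ := hV.2
  have hsub := isSubharmonicOn_of_mem_sbh00 hD hV
  -- truncation at the negative level `-1`, so that `0 ≤ truncExt` means `0 ≤ V`
  have hloc : ∀ x, x ≠ o → LocSub (truncExt 1 D o V) x := fun x hx =>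
    locSub_truncExt zero_le_one hsub (hTD.trans interior_subset) hT hx
  have hpos : 0 < ‖y - o‖ := norm_pos_iff.2 (sub_ne_zero.2 hy.2)
  have hKo : ∀ x : Space 1, 0 ≤ inner ℝ (x - y) (y - o) → x ≠ o := by
    rintro x hx rfl
    rw [← neg_sub y x, inner_neg_left, real_inner_self_eq_norm_sq] at hx
    nlinarith
  have hunb : ¬ Bornology.IsBounded {x : Space 1 | 0 ≤ inner ℝ (x - y) (y - o)} := by
    intro hb
    obtain ⟨M, hM⟩ := hb.exists_norm_le
    obtain ⟨n, hn⟩ := exists_nat_gt ((M + ‖y‖) / ‖y - o‖)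
    have h1 := hM (y + (n : ℝ) • (y - o)) (by
      change 0 ≤ inner ℝ (y + (n : ℝ) • (y - o) - y) (y - o)
      rw [add_sub_cancel_left, inner_smul_left, real_inner_self_eq_norm_sq]
      simp only [conj_trivial]
      positivity)
    have h2 : ‖(n : ℝ) • (y - o)‖ ≤ ‖y + (n : ℝ) • (y - o)‖ + ‖y‖ := by
      have := norm_sub_le (y + (n : ℝ) • (y - o)) y
      rwa [add_sub_cancel_left] at this
    rw [norm_smul, Real.norm_natCast] at h2
    rw [div_lt_iff₀ hpos] at hn
    linarith
  obtain ⟨z, hz, hz0, -⟩ := LocSub.exists_isMaxOn_diff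
    (U := {x : Space 1 | 0 < inner ℝ (x - y) (y - o)})
    (K := {x : Space 1 | 0 ≤ inner ℝ (x - y) (y - o)}) (C := closure T) (p := o)
    (v := truncExt 1 D o V)
    (isOpen_lt continuous_const (by fun_prop))
    (fun x (hx : 0 < inner ℝ (x - y) (y - o)) => hx.le)
    (isClosed_le continuous_const (by fun_prop)) hunb (fun h => hKo o h rfl)
    (fun x (hx : 0 < inner ℝ (x - y) (y - o)) => hloc x (hKo x hx.le))
    (fun x hx => (hloc x (hKo x hx)).usc.upperSemicontinuousWithinAt _) hTc
    (fun x _ hx => truncExt_eq_zero zero_le_one hT fun h => hx (subset_closure h))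
  have hz' : inner ℝ (z - y) (y - o) = 0 := le_antisymm (not_lt.1 hz.2) hz.1
  have hzy : z = y := by
    have h1 := inner_sq_space_one (z - y) (y - o)
    rw [hz'] at h1
    have h2 : ‖z - y‖ ^ 2 = 0 := by
      have : ‖y - o‖ ^ 2 ≠ 0 := by positivity
      have h3 : ‖z - y‖ ^ 2 * ‖y - o‖ ^ 2 = 0 := by rw [← h1]; ring
      exact (mul_eq_zero.1 h3).resolve_right this
    rw [sq_eq_zero_iff, norm_eq_zero, sub_eq_zero] at h2
    exact h2
  rw [hzy, truncExt, indicator_of_mem hy, le_trunc_iff (hsub.ne_top y hy) (by norm_num)] at hz0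
  simpa using hz0

/-- On the line, `V + |· - o|` is convex and equals `|· - o|` outside a compact subset of `D`, so it
is at most `|· - p| + |o - p|`, which is affine off `p`, for a point `p` outside `D`. -/
theorem le_of_mem_poleExtends {D : Set (Space 1)} {o p : Space 1} (hD : IsOpen D) (ho : o ∈ D)
    (hp : p ∉ D) {V : Space 1 → EReal} (hV : V ∈ sbh00 D {o}) (hVe : V ∈ poleExtends D o)
    {y : Space 1} (hy : y ∈ D \ {o}) : V y ≤ ((2 * ‖o - p‖ : ℝ) : EReal) := by
  obtain ⟨T, ⟨hTc, hTD⟩, hT⟩ := hV.2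
  obtain ⟨W, hW, hWV⟩ := hVe
  have hWs := isSubharmonicOn_of_mem_sbh hD hW
  have hk : ∀ z ∈ D \ {o}, W z = V z + ((‖z - o‖ : ℝ) : EReal) := by
    intro z hz
    have h1 : kFun (((1 : ℕ) : ℝ) - 2) ‖z - o‖ = ‖z - o‖ := by
      rw [kFun, if_neg (by norm_num), Real.sign_of_neg (by norm_num)]
      norm_num
    rw [hWV z hz, kernelK_of_ne hz.2, h1]
  have hnp : ∀ z ∈ D, z ≠ p := fun z hz h => hp (h ▸ hz)
  have hmax := LocSub.nonpos_of_isCompact (U := D) (C := insert o (closure T))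
    (φ := fun z => (trunc 0 W z + -‖z - p‖) + -‖o - p‖) hD (hTc.insert o)
    (insert_subset ho (hTD.trans interior_subset))
    (fun z hz => ((hWs.locSub_trunc 0 hz).add (locSub_neg_norm_sub (hnp z hz))).add
      (LocSub.const _ z)) (fun z hz hpos => ?_) y hy.1
  · have h1 := le_coe_trunc 0 (hWs.ne_top y hy.1)
    rw [hk y hy] at h1
    have h2 : ‖y - p‖ ≤ ‖y - o‖ + ‖o - p‖ := norm_sub_le_norm_sub_add_norm_sub y o p
    have h3 : V y + ((‖y - o‖ : ℝ) : EReal)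
        ≤ ((2 * ‖o - p‖ : ℝ) : EReal) + ((‖y - o‖ : ℝ) : EReal) := by
      rw [← EReal.coe_add]
      exact h1.trans (EReal.coe_le_coe_iff.2 (by linarith))
    exact (EReal.addLECancellable_coe _).add_le_add_iff_right.1 h3
  · by_contra hzC
    rw [mem_insert_iff, not_or] at hzC
    have hzD : z ∈ D \ {o} := ⟨hz, hzC.1⟩
    have hWz : W z = ((‖z - o‖ : ℝ) : EReal) := by
      rw [hk z hzD, hT z ⟨hzD, fun h => hzC.2 (subset_closure h)⟩, zero_add]
    rw [trunc_coe hWz, neg_zero, max_eq_left (norm_nonneg _)] at hpos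
    have := norm_sub_le_norm_sub_add_norm_sub z p o
    rw [norm_sub_rev p o] at this
    linarith

theorem nonempty_of_not_isPolar {E : Set (Space d)} (hE : ¬ IsPolar E) : E.Nonempty := by
  rw [nonempty_iff_ne_empty]
  rintro rfl
  refine hE ⟨fun _ => 0, ⟨isOpen_univ, by simp, upperSemicontinuousOn_const, ?_⟩, ⟨0, by simp⟩,
    by simp⟩
  intro x ρ _ _
  simp [sphereMean]

/-! ### The embedding -/

/-- Two-sided bounds for all Arens–Singer potentials that are harmonic near the pole. -/
theorem exists_bound (hd : 1 ≤ d) {D D₀ S : Set (Space d)} {o : Space d} (hD : IsOpen D)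
    (hDnp : ¬ IsPolar (frontier D)) (hoS : o ∈ interior S) {r : ℝ} (hr : 0 < r) (hD₀ : IsOpen D₀)
    (hD₀c : IsConnected D₀) (hSD₀ : PrecompactIn (thickening (4 * r) S) D₀)
    (hD₀D : PrecompactIn D₀ D) :
    ∃ B : ℝ, 0 < B ∧ ∀ V ∈ ASP D o ∩ har (D₀ \ {o}), (d = 1 → V ∈ poleExtends D o) →
      (∀ x ∈ D \ S, V x ≤ B) ∧ ∀ x ∈ thickening (4 * r) S \ S, ((-B : ℝ) : EReal) ≤ V x := by
  have hD₀D' : D₀ ⊆ D := (subset_closure.trans hD₀D.2).trans interior_subset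
  have hSD₀' : closure (thickening (4 * r) S) ⊆ D₀ := hSD₀.2.trans interior_subset
  have hSt : S ⊆ thickening (4 * r) S := self_subset_thickening (by positivity) S
  have hoS' : o ∈ S := interior_subset hoS
  have ho : o ∈ D₀ := hSD₀' (subset_closure (hSt hoS'))
  obtain ⟨δ, hδ, hδS⟩ := Metric.isOpen_iff.1 isOpen_interior o hoS
  rcases hd.eq_or_lt with rfl | hd2
  · obtain ⟨p, hp⟩ := nonempty_of_not_isPolar hDnp
    rw [hD.frontier_eq] at hp
    have hne : ∀ x, x ∉ S → x ≠ o := fun x hx h => hx (h ▸ hoS')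
    have hB : (0 : ℝ) < 2 * ‖o - p‖ + 1 := by positivity
    refine ⟨2 * ‖o - p‖ + 1, hB, fun V hV hVe => ⟨fun x hx => ?_, fun x hx => ?_⟩⟩
    · exact (le_of_mem_poleExtends hD (hD₀D' ho) hp.2 hV.1.1 (hVe rfl) ⟨hx.1, hne x hx.2⟩).trans
        (EReal.coe_le_coe_iff.2 (by linarith))
    · refine le_trans ?_ (nonneg_of_mem_sbh00 hD hV.1.1
        ⟨hD₀D' (hSD₀' (subset_closure hx.1)), hne x hx.2⟩)
      rw [← EReal.coe_zero, EReal.coe_le_coe_iff]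
      linarith
  · have hfar : ∀ x, x ∉ S → x ∉ ball o δ := fun x hx h => hx (interior_subset (hδS h))
    obtain ⟨B₁, hB₁0, hB₁⟩ := exists_upper_bound hd2 hD hDnp hD₀ hD₀c.isPreconnected hD₀D' ho hδ
    obtain ⟨B₂, hB₂⟩ := exists_lower_bound hd2 hD hDnp hD₀ hD₀c.isPreconnected hD₀D' ho
      (K := closure (thickening (4 * r) S) \ ball o δ) (hSD₀.1.diff isOpen_ball)
      fun x hx => ⟨hSD₀' hx.1, fun h => hx.2 (mem_singleton_iff.1 h ▸ mem_ball_self hδ)⟩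
    refine ⟨max B₁ B₂ + 1, by linarith [le_max_left B₁ B₂], fun V hV _ =>
      ⟨fun x hx => ?_, fun x hx => ?_⟩⟩
    · refine (hB₁ V hV x hx.1 ?_).trans
        (EReal.coe_le_coe_iff.2 (by linarith [le_max_left B₁ B₂]))
      have := hfar x hx.2
      rwa [mem_ball, dist_eq_norm, not_lt] at this
    · refine le_trans (EReal.coe_le_coe_iff.2 (by linarith [le_max_right B₁ B₂]))
        (hB₂ V hV x ⟨subset_closure hx.1, hfar x hx.2⟩)

end

end PotentialTheory

end

theorem theoreml2 (d : ℕ) (hd : 1 ≤ d)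
    (D : Set (Space d)) (hDo : IsOpen D) (hDc : IsConnected D) (hDnp : ¬ IsPolar (frontier D))
    (o : Space d) (S : Set (Space d)) (hoS : o ∈ interior S)
    (r : ℝ) (hr : 0 < r)
    (D₀ : Set (Space d)) (hD₀o : IsOpen D₀) (hD₀c : IsConnected D₀)
    (hSD₀ : PrecompactIn (Metric.thickening (4 * r) S) D₀) (hD₀D : PrecompactIn D₀ D) :
    ∃ B : ℝ, 0 < B ∧
      (IsConnected S →
        ∀ V ∈ ASP1 D o ∩ har (D₀ \ {o}), (d = 1 → V ∈ poleExtends D o) →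
          V ∈ sbh00Between D S r (-B) B) ∧
      (∀ V ∈ JP1 D o ∩ har (D₀ \ {o}), (d = 1 → V ∈ poleExtends D o) →
          V ∈ sbh00PosLe D S B) := by
  obtain ⟨B, hB, h⟩ := exists_bound hd hDo hDnp hoS hr hD₀o hD₀c hSD₀ hD₀D
  have hoS' : ({o} : Set (Space d)) ⊆ S := singleton_subset_iff.2 (interior_subset hoS)
  have hsub : D \ S ⊆ D \ {o} := sdiff_subset_sdiff_right hoS'
  have hsbh : ∀ V ∈ sbh00 D {o}, V ∈ sbh00 D S := by
    rintro V ⟨⟨O, u, hO, hu, he⟩, T, hT, hVT⟩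
    exact ⟨⟨O, u, hsub.trans hO, hu, he.mono hsub⟩, T, hT, fun x hx => hVT x ⟨hsub hx.1, hx.2⟩⟩
  refine ⟨B, hB, fun _ V hV hVe => ?_, fun V hV hVe => ?_⟩
  · obtain ⟨h1, h2⟩ := h V ⟨hV.1.1, hV.2⟩ hVe
    exact ⟨⟨hsbh V hV.1.1.1, h1⟩, h2⟩
  · obtain ⟨h1, -⟩ := h V ⟨hV.1.1.1, hV.2⟩ hVe
    exact ⟨⟨hsbh V hV.1.1.1.1, h1⟩, fun x hx => hV.1.2 x (hsub hx)⟩
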